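/- Let $k$ be a field and let $S=\bigoplus_{i\ge 0}S_i$ be a homogeneous graded ring over $k$, i.e. $S_0=k$ and $S$ is generated as a $k$-algebra by finitely many elements of degree one; let $\mathfrak n=\bigoplus_{i\ge 1}S_i$ be its graded maximal ideal. Assume that $S$ is Cohen–Macaulay of Krull dimension one, is not Gorenstein, and has minimal multiplicity, i.e. there is a system of parameters $y$ (an element $y\in S$ with $\sqrt{yS}=\mathfrak n$) such that $y\,\mathfrak n=\mathfrak n^2$. Let $x\in\mathfrak n$ be a minimal reduction of $\mathfrak n$, i.e. $x\,\mathfrak n=\mathfrak n^2$, and set $R=S/x^2S$ and $\mathfrak m=\mathfrak nR$, so that $R/\mathfrak m\cong k$. Say that a finitely generated $R$-module $M$ has G-dimension zero if the natural map $M\to \mathrm{Hom}_R(\mathrm{Hom}_R(M,R),R)$ is an isomorphism and $\mathrm{Ext}^i_R(M,R)=0=\mathrm{Ext}^i_R(\mathrm{Hom}_R(M,R),R)$ for all $i>0$; let $\mathcal G(R)$ be the full subcategory of such modules in the category $R\text{-mod}$ of finitely generated $R$-modules. A (right) $\mathcal G(R)$-approximation of $M\in R\text{-mod}$ is a surjective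 homomorphism $\pi:X\to M$ with $X\in\mathcal G(R)$ such that every homomorphism from an object of $\mathcal G(R)$ to $M$ factors through $\pi$; and $\mathcal G(R)$ is called contravariantly finite in $R\text{-mod}$ if every $M\in R\text{-mod}$ has a $\mathcal G(R)$-approximation. Then the $R$-module $k=R/\mathfrak m$ has no $\mathcal G(R)$-approximation. In particular, $\mathcal G(R)$ is not contravariantly finite in $R\text{-mod}$. -/

import Mathlib

open CategoryTheory

universe u v

/-- `𝒜` makes the `k`-algebra `S` a homogeneous graded ring over `k`: the degree-zero part
is `k`, and `S` is generated over `k` by finitely many elements of degree one, i.e. `S` is a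
quotient of a standard graded polynomial ring `k[X₀, …, X_r]` by a homogeneous ideal. -/
structure IsHomogeneousGradedRing {k : Type u} {S : Type v} [Field k] [CommRing S] [Algebra k S]
    (𝒜 : ℕ → Submodule k S) [GradedAlgebra 𝒜] : Prop where
  degree_zero : 𝒜 0 = 1
  finite_degree_one : Module.Finite k (𝒜 1)
  generated_in_degree_one : Algebra.adjoin k (𝒜 1 : Set S) = ⊤

/-- A Cohen-Macaulay local ring: a Noetherian local ring with `depth R = dim R`, i.e. with a
regular sequence in the maximal ideal whose length is the Krull dimension. -/
def IsCohenMacaulayLocal (R : Type u) [CommRing R] [IsLocalRing R] : Prop :=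
  IsNoetherianRing R ∧ ∃ rs : List R, (∀ r ∈ rs, r ∈ IsLocalRing.maximalIdeal R) ∧
    RingTheory.Sequence.IsRegular R rs ∧ (rs.length : WithBot ℕ∞) = ringKrullDim R

/-- A Cohen-Macaulay ring: Noetherian, with all localizations at maximal ideals
Cohen-Macaulay. -/
def IsCohenMacaulay (R : Type u) [CommRing R] : Prop :=
  IsNoetherianRing R ∧ ∀ (m : Ideal R) [m.IsMaximal],
    IsCohenMacaulayLocal (Localization.AtPrime m)

/-- A Gorenstein local ring: a Noetherian local ring of finite injective dimension over
itself. -/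
def IsGorensteinLocal (R : Type u) [CommRing R] [IsLocalRing R] : Prop :=
  IsNoetherianRing R ∧ ∃ n : ℕ, HasInjectiveDimensionLE (ModuleCat.of R R) n

/-- A Gorenstein ring: Noetherian, with all localizations at maximal ideals Gorenstein. -/
def IsGorenstein (R : Type u) [CommRing R] : Prop :=
  IsNoetherianRing R ∧ ∀ (m : Ideal R) [m.IsMaximal],
    IsGorensteinLocal (Localization.AtPrime m)

/-- Minimal multiplicity with respect to the (graded) maximal ideal `n`: some system of
parameters `xs` satisfies `(xs) n = n ^ 2`. -/
def HasMinimalMultiplicity {S : Type u} [CommRing S] (n : Ideal S) : Prop :=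
  ∃ xs : List S, (xs.length : WithBot ℕ∞) = ringKrullDim S ∧
    (Ideal.ofList xs).radical = n ∧ Ideal.ofList xs * n = n ^ 2

/-- In dimension one and minimal multiplicity: `x ∈ n` is a minimal reduction of the (graded)
maximal ideal `n` if `x n = n ^ 2`. -/
def IsMinimalReduction {S : Type u} [CommRing S] (x : S) (n : Ideal S) : Prop :=
  x ∈ n ∧ Ideal.span {x} * n = n ^ 2

/-- `M` is a finitely generated `R`-module of G-dimension zero, i.e. an object of `𝒢(R)`. -/
structure HasGDimZero (R : Type u) (M : Type u) [CommRing R] [AddCommGroup M] [Module R M] :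
    Prop where
  finite : Module.Finite R M
  bijective_dual_eval : Function.Bijective (Module.Dual.eval R M)
  ext_eq_zero : ∀ i : ℕ, 0 < i →
    Subsingleton (Abelian.Ext (ModuleCat.of R M) (ModuleCat.of R R) i)
  ext_dual_eq_zero : ∀ i : ℕ, 0 < i →
    Subsingleton (Abelian.Ext (ModuleCat.of R (Module.Dual R M)) (ModuleCat.of R R) i)

/-- `π : X → M` is a right `𝒢(R)`-approximation of `M`: `X ∈ 𝒢(R)`, the sequence
`0 → ker π → X → M → 0` is exact, and any morphism to `M` from any object of `𝒢(R)` factors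
through `π`. -/
structure IsRightGApproximation (R : Type u) [CommRing R] {X M : Type u} [AddCommGroup X]
    [Module R X] [AddCommGroup M] [Module R M] (π : X →ₗ[R] M) : Prop where
  hasGDimZero : HasGDimZero R X
  surjective : Function.Surjective π
  factors : ∀ (X' : Type u) [AddCommGroup X'] [Module R X'], HasGDimZero R X' →
    ∀ f : X' →ₗ[R] M, ∃ g : X' →ₗ[R] X, π ∘ₗ g = f

/-- `M` has a right `𝒢(R)`-approximation. -/
def HasRightGApproximation (R : Type u) (M : Type u) [CommRing R] [AddCommGroup M]
    [Module R M] : Prop :=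
  ∃ (X : Type u) (_ : AddCommGroup X) (_ : Module R X) (π : X →ₗ[R] M),
    IsRightGApproximation R π

/-- `𝒢(R)` is a contravariantly finite subcategory of the category of finitely generated
`R`-modules. -/
def GDimZeroContravariantlyFinite (R : Type u) [CommRing R] : Prop :=
  ∀ (M : Type u) [AddCommGroup M] [Module R M], Module.Finite R M → HasRightGApproximation R M

/-- The residue field of `R = S ⧸ x² S` at the image of the (graded) maximal ideal `n` of `S`,
as a quotient of `R`. -/
abbrev residueQuotient {S : Type u} [CommRing S] (n : Ideal S) (x : S) : Type u :=
  (S ⧸ Ideal.span {x ^ 2}) ⧸ n.map (Ideal.Quotient.mk (Ideal.span {x ^ 2}))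

/-! Put s = dim 𝔪² over k. Cohen–Macaulayness makes x a nonzerodivisor of S
(`IsHomogeneousGradedRing.eq_zero_of_mul_eq_zero`), so in R one has (0 : x) = (x), x𝔪 = 𝔪² and 𝔪³ =
0. The periodic sequence 0 → R/(x) → R → R/(x) → 0 then puts R/(x) in 𝒢(R).

Suppose k has an approximation, and pass to a right minimal one π : X → k with kernel Y. Lifting the
map R/(x) → k gives a ∈ X over 1 with xa = 0, so X = Y + Ra and xX = xY. Wakamatsu's lemma says that
an element of Y killed by x lies in xY. Hence dim Y = 2 dim xX and dim X = 2 dim xX + 1. Since a is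
killed by x but lies outside 𝔪X, also dim 𝔪X ≤ dim xX, and therefore dim X/𝔪X > dim 𝔪X.

On the other hand, minimality rules out a free summand, so every functional on the reflexive module
X has values in 𝔪, and 𝔪³ = 0 gives 𝔪²X = 0. For such X with Ext¹(X, R) = 0, counting homomorphisms
into R yields dim X/𝔪X ≤ dim 𝔪X as soon as s ≥ 2 (`finrank_quotient_le_finrank_smul`), a
contradiction.

The bound s ≥ 2 comes from S not being Gorenstein: dim S₁ ≤ s + 1, and if dim S₁ ≤ 2 then S is free
over k[z], z the linear part of x, with basis 1 or 1, y. It is then a Frobenius extension of a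
principal ideal domain, hence Gorenstein (`isGorenstein_of_finrank_le_two`). -/

/-! ### Long exact sequences of Ext for modules. -/

section ExtModule

variable {R : Type u} [CommRing R] {M M' N A B C : Type u} [AddCommGroup M] [Module R M]
  [AddCommGroup M'] [Module R M'] [AddCommGroup N] [Module R N]
  [AddCommGroup A] [Module R A] [AddCommGroup B] [Module R B] [AddCommGroup C] [Module R C]

theorem moduleCat_shortExact {R : Type v} [CommRing R] {A B C : Type u} [AddCommGroup A]
    [Module R A] [AddCommGroup B] [Module R B] [AddCommGroup C] [Module R C]
    {f : A →ₗ[R] B} {g : B →ₗ[R] C} (hf : Function.Injective f)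
    (hfg : Function.Exact f g) (hg : Function.Surjective g) :
    (ModuleCat.shortComplexOfCompEqZero f g hfg.linearMap_comp_eq_zero).ShortExact :=
  ModuleCat.shortComplex_shortExact _ hfg hf hg

open Abelian

theorem subsingleton_ext_of_retract (i : M' →ₗ[R] M) (p : M →ₗ[R] M') (h : p ∘ₗ i = .id)
    (n : ℕ) [Subsingleton (Ext (ModuleCat.of R M) (ModuleCat.of R N) n)] :
    Subsingleton (Ext (ModuleCat.of R M') (ModuleCat.of R N) n) := by
  refine subsingleton_of_forall_eq 0 fun e ↦ ?_
  have h1 : (Ext.mk₀ (ModuleCat.ofHom p)).comp e (zero_add n) = 0 := Subsingleton.elim _ _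
  have h2 : ModuleCat.ofHom i ≫ ModuleCat.ofHom p = 𝟙 _ := by
    rw [← ModuleCat.ofHom_comp, h]; rfl
  rw [← Ext.mk₀_id_comp e, ← h2, ← Ext.mk₀_comp_mk₀_assoc, h1, Ext.comp_zero]

theorem subsingleton_ext_middle {f : A →ₗ[R] B} {g : B →ₗ[R] C} (hf : Function.Injective f)
    (hfg : Function.Exact f g) (hg : Function.Surjective g) (n : ℕ)
    [hA : Subsingleton (Ext (ModuleCat.of R A) (ModuleCat.of R N) n)]
    [hC : Subsingleton (Ext (ModuleCat.of R C) (ModuleCat.of R N) n)] :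
    Subsingleton (Ext (ModuleCat.of R B) (ModuleCat.of R N) n) := by
  refine subsingleton_of_forall_eq 0 fun e ↦ ?_
  obtain ⟨e', rfl⟩ := Ext.contravariant_sequence_exact₂ (moduleCat_shortExact hf hfg hg) _ e
    (hA.elim _ _)
  rw [hC.elim e' 0, Ext.comp_zero]

theorem exists_comp_eq_of_subsingleton_ext_one {f : A →ₗ[R] B} {g : B →ₗ[R] C}
    (hf : Function.Injective f) (hfg : Function.Exact f g) (hg : Function.Surjective g)
    [hC : Subsingleton (Ext (ModuleCat.of R C) (ModuleCat.of R N) 1)] (φ : A →ₗ[R] N) :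
    ∃ ψ : B →ₗ[R] N, ψ ∘ₗ f = φ := by
  obtain ⟨e, he⟩ := Ext.contravariant_sequence_exact₁ (moduleCat_shortExact hf hfg hg) _
    (Ext.mk₀ (ModuleCat.ofHom φ)) (add_zero 1) (hC.elim _ _)
  obtain ⟨ψ, rfl⟩ := Ext.mk₀_bijective _ _ |>.2 e
  rw [Ext.mk₀_comp_mk₀] at he
  have := (Ext.mk₀_bijective _ _).1 he
  exact ⟨ψ.hom, by simpa using congrArg ModuleCat.Hom.hom this⟩

theorem subsingleton_ext_one_of_projective_middle {f : A →ₗ[R] B} {g : B →ₗ[R] C}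
    (hf : Function.Injective f) (hfg : Function.Exact f g) (hg : Function.Surjective g)
    [Module.Projective R B]
    (h : ∀ φ : A →ₗ[R] N, ∃ ψ : B →ₗ[R] N, ψ ∘ₗ f = φ) :
    Subsingleton (Ext (ModuleCat.of R C) (ModuleCat.of R N) 1) := by
  have : Projective (ModuleCat.of R B) := inferInstance
  refine subsingleton_of_forall_eq 0 fun e ↦ ?_
  obtain ⟨e', rfl⟩ := Ext.contravariant_sequence_exact₃ (moduleCat_shortExact hf hfg hg) _ e
    (Ext.eq_zero_of_projective _) (add_zero 1)
  obtain ⟨φ, rfl⟩ := Ext.mk₀_bijective _ _ |>.2 e'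
  obtain ⟨ψ, hψ⟩ := h φ.hom
  have : φ = ModuleCat.ofHom f ≫ ModuleCat.ofHom ψ := by
    rw [← ModuleCat.ofHom_comp, hψ]; rfl
  rw [this, ← Ext.mk₀_comp_mk₀]
  exact (moduleCat_shortExact hf hfg hg).extClass_comp_assoc _ 

theorem subsingleton_ext_succ_of_projective_middle {f : A →ₗ[R] B} {g : B →ₗ[R] C}
    (hf : Function.Injective f) (hfg : Function.Exact f g) (hg : Function.Surjective g)
    [Module.Projective R B] (n : ℕ)
    [hA : Subsingleton (Ext (ModuleCat.of R A) (ModuleCat.of R N) n)] :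
    Subsingleton (Ext (ModuleCat.of R C) (ModuleCat.of R N) (n + 1)) := by
  have : Projective (ModuleCat.of R B) := inferInstance
  refine subsingleton_of_forall_eq 0 fun e ↦ ?_
  obtain ⟨e', rfl⟩ := Ext.contravariant_sequence_exact₃ (moduleCat_shortExact hf hfg hg) _ e
    (Ext.eq_zero_of_projective _) (add_comm 1 n)
  rw [hA.elim e' 0, Ext.comp_zero]

end ExtModule

/-! ### Closure of 𝒢(R) under retracts and extensions. -/

namespace HasGDimZero

variable {R : Type u} [CommRing R]

theorem of_retract {M M' : Type u} [AddCommGroup M] [Module R M] [AddCommGroup M'] [Module R M']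
    (hM : HasGDimZero R M) (i : M' →ₗ[R] M) (p : M →ₗ[R] M') (h : p ∘ₗ i = .id) :
    HasGDimZero R M' where
  finite := have := hM.finite; .of_surjective p fun y ↦ ⟨i y, LinearMap.congr_fun h y⟩
  bijective_dual_eval := by
    have hpi (y : M') : p (i y) = y := LinearMap.congr_fun h y
    constructor
    · intro a b hab
      have : i a = i b := hM.bijective_dual_eval.1 <| LinearMap.ext fun φ ↦
        LinearMap.congr_fun hab (φ ∘ₗ i)
      rw [← hpi a, this, hpi]
    · intro Φ
      obtain ⟨a, ha⟩ := hM.bijective_dual_eval.2 (Φ ∘ₗ i.dualMap)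
      refine ⟨p a, LinearMap.ext fun φ ↦ ?_⟩
      have := LinearMap.congr_fun ha (φ ∘ₗ p)
      simp only [Module.Dual.eval_apply, LinearMap.comp_apply] at this ⊢
      rw [this]
      congr 1
      ext y
      simp [hpi]
  ext_eq_zero n hn := have := hM.ext_eq_zero n hn; subsingleton_ext_of_retract i p h n
  ext_dual_eq_zero n hn :=
    have := hM.ext_dual_eq_zero n hn
    subsingleton_ext_of_retract p.dualMap i.dualMap
      (LinearMap.ext fun φ ↦ LinearMap.ext fun y ↦ congrArg φ (LinearMap.congr_fun h y)) n

/-- Since Ext¹(C, R) = 0, the dual sequence is again short exact. Biduality is then a five lemma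
argument, and both Ext conditions come from the long exact sequences. -/
theorem of_exact {A B C : Type u} [AddCommGroup A] [Module R A] [AddCommGroup B] [Module R B]
    [AddCommGroup C] [Module R C] {f : A →ₗ[R] B} {g : B →ₗ[R] C} (hf : Function.Injective f)
    (hfg : Function.Exact f g) (hg : Function.Surjective g) (hA : HasGDimZero R A)
    (hC : HasGDimZero R C) : HasGDimZero R B := by
  have hf' : Function.Surjective f.dualMap := fun φ ↦
    have := hC.ext_eq_zero 1 one_pos
    exists_comp_eq_of_subsingleton_ext_one hf hfg hg φ
  have hg' : Function.Injective g.dualMap := LinearMap.dualMap_injective_of_surjective hg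
  have hgf : Function.Exact g.dualMap f.dualMap := fun φ ↦ by
    refine ⟨fun h ↦ ?_, ?_⟩
    · refine ⟨(LinearMap.ker g).liftQ φ (fun b hb ↦ ?_) ∘ₗ
        (g.quotKerEquivOfSurjective hg).symm.toLinearMap, ?_⟩
      · obtain ⟨a, rfl⟩ := (hfg b).1 hb
        exact LinearMap.congr_fun h a
      · ext b
        have : (g.quotKerEquivOfSurjective hg).symm (g b) = Submodule.Quotient.mk b := by
          rw [LinearEquiv.symm_apply_eq]; rfl
        simp [this]
    · rintro ⟨φ, rfl⟩
      ext a
      simp [hfg.apply_apply_eq_zero]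
  refine ⟨?_, ⟨?_, ?_⟩, fun n hn ↦ ?_, fun n hn ↦ ?_⟩
  · have := hA.finite
    have := hC.finite
    exact Module.Finite.of_exact hfg hg
  · rw [← LinearMap.ker_eq_bot, LinearMap.ker_eq_bot']
    intro b hb
    have hgb : g b = 0 := (map_eq_zero_iff _ hC.bijective_dual_eval.1).1 <|
      LinearMap.ext fun φ ↦ LinearMap.congr_fun hb (φ ∘ₗ g)
    obtain ⟨a, rfl⟩ := (hfg b).1 hgb
    have : a = 0 := (map_eq_zero_iff _ hA.bijective_dual_eval.1).1 <| LinearMap.ext fun φ ↦ by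
      obtain ⟨ψ, rfl⟩ := hf' φ
      exact LinearMap.congr_fun hb ψ
    rw [this, map_zero]
  · intro Φ
    -- Subtracting evaluation at a lift `b` of `c` makes Φ vanish on functionals coming from C; the
    -- difference descends to the bidual of A.
    obtain ⟨c, hc⟩ := hC.bijective_dual_eval.2 (Φ ∘ₗ g.dualMap)
    obtain ⟨b, rfl⟩ := hg c
    let Φ' := Φ - Module.Dual.eval R B b
    let Ψ : Module.Dual R (Module.Dual R A) := (LinearMap.ker f.dualMap).liftQ Φ' (fun φ hφ ↦ by
      obtain ⟨ψ, rfl⟩ := (hgf φ).1 hφ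
      have := LinearMap.congr_fun hc ψ
      simp only [Module.Dual.eval_apply, LinearMap.comp_apply] at this
      simp [Φ', ← this]) ∘ₗ (f.dualMap.quotKerEquivOfSurjective hf').symm.toLinearMap
    obtain ⟨a, ha⟩ := hA.bijective_dual_eval.2 Ψ
    refine ⟨f a + b, LinearMap.ext fun φ ↦ ?_⟩
    have h1 := LinearMap.congr_fun ha (f.dualMap φ)
    have : (f.dualMap.quotKerEquivOfSurjective hf').symm (f.dualMap φ) =
        Submodule.Quotient.mk φ := by
      rw [LinearEquiv.symm_apply_eq]; rfl
    simp only [Ψ, LinearMap.comp_apply, LinearEquiv.coe_coe, this, Φ',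
      ← Submodule.mkQ_apply] at h1
    simp at h1 ⊢
    rw [h1]; abel
  · have := hA.ext_eq_zero n hn
    have := hC.ext_eq_zero n hn
    exact subsingleton_ext_middle hf hfg hg n
  · have := hA.ext_dual_eq_zero n hn
    have := hC.ext_dual_eq_zero n hn
    exact subsingleton_ext_middle hg' hgf hf' n

end HasGDimZero

/-! ### The module R/(x) when (0 : x) = (x). -/

section ExactPair

variable {R : Type u} [CommRing R] {x : R}

/-- Multiplication by `x` as a map `R ⧸ (x) → R`, when `x ^ 2 = 0`. -/
def quotientMulOfSqZero (hx : x * x = 0) : (R ⧸ Ideal.span {x}) →ₗ[R] R :=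
  (Ideal.span {x}).liftQ (LinearMap.mulLeft R x) <| by
    rw [Ideal.span, Submodule.span_le, Set.singleton_subset_iff]
    exact hx

theorem quotientMulOfSqZero_mk (hx : x * x = 0) (r : R) :
    quotientMulOfSqZero hx (Ideal.Quotient.mk _ r) = x * r := rfl

theorem quotientMulOfSqZero_injective (hx : x * x = 0) (h : ∀ r, x * r = 0 → x ∣ r) :
    Function.Injective (quotientMulOfSqZero hx) := by
  rw [← LinearMap.ker_eq_bot, LinearMap.ker_eq_bot']
  intro a
  obtain ⟨r, rfl⟩ := Ideal.Quotient.mk_surjective a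
  rw [quotientMulOfSqZero_mk]
  exact fun hr ↦ Ideal.Quotient.eq_zero_iff_mem.2 (Ideal.mem_span_singleton.2 (h r hr))

theorem exact_quotientMulOfSqZero_mkQ (hx : x * x = 0) :
    Function.Exact (quotientMulOfSqZero hx) (Ideal.span {x}).mkQ := by
  intro r
  rw [Submodule.mkQ_apply, Submodule.Quotient.mk_eq_zero, Ideal.mem_span_singleton]
  constructor
  · rintro ⟨c, rfl⟩
    exact ⟨Ideal.Quotient.mk _ c, rfl⟩
  · rintro ⟨a, rfl⟩
    obtain ⟨c, rfl⟩ := Ideal.Quotient.mk_surjective a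
    exact ⟨c, rfl⟩

theorem smul_eq_zero_of_quotient_span (φ : (R ⧸ Ideal.span {x}) →ₗ[R] R) (a) : x * φ a = 0 := by
  obtain ⟨r, rfl⟩ := Ideal.Quotient.mk_surjective a
  rw [← smul_eq_mul, ← map_smul]
  convert map_zero φ
  exact Ideal.Quotient.eq_zero_iff_mem.2 (Ideal.mem_span_singleton.2 (dvd_mul_right x r))

/-- If `(0 : x) = (x)`, the `R`-dual of `R ⧸ (x)` is again `R ⧸ (x)`. -/
theorem exists_linearEquiv_dual_quotient_span (hx : x * x = 0) (h : ∀ r, x * r = 0 → x ∣ r) :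
    Nonempty ((R ⧸ Ideal.span {x}) ≃ₗ[R] Module.Dual R (R ⧸ Ideal.span {x})) := by
  let f := quotientMulOfSqZero hx
  let g : (R ⧸ Ideal.span {x}) →ₗ[R] Module.Dual R (R ⧸ Ideal.span {x}) :=
    (Ideal.span {x}).liftQ (LinearMap.toSpanSingleton R _ f) <| by
      refine (Submodule.span_singleton_le_iff_mem x _).2 ?_
      exact LinearMap.ext fun a ↦ smul_eq_zero_of_quotient_span f a
  refine ⟨LinearEquiv.ofBijective g ⟨?_, fun φ ↦ ?_⟩⟩
  · rw [← LinearMap.ker_eq_bot, LinearMap.ker_eq_bot']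
    intro a ha
    obtain ⟨r, rfl⟩ := Ideal.Quotient.mk_surjective a
    have h1 : r * (x * 1) = 0 := LinearMap.congr_fun ha (Ideal.Quotient.mk _ 1)
    exact Ideal.Quotient.eq_zero_iff_mem.2 (Ideal.mem_span_singleton.2
      (h r (by linear_combination h1)))
  · obtain ⟨c, hc⟩ := h _ (smul_eq_zero_of_quotient_span φ (Ideal.Quotient.mk _ 1))
    refine ⟨Ideal.Quotient.mk _ c, LinearMap.ext fun a ↦ ?_⟩
    obtain ⟨r, rfl⟩ := Ideal.Quotient.mk_surjective a
    have h1 : (Ideal.Quotient.mk (Ideal.span {x})) r = r • Ideal.Quotient.mk _ 1 := by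
      rw [← Ideal.Quotient.mk_eq_mk, ← Ideal.Quotient.mk_eq_mk, ← Submodule.Quotient.mk_smul,
        smul_eq_mul, mul_one]
    rw [h1, map_smul, map_smul, hc]
    congr 1
    change c * (x * 1) = x * c
    ring

/-- Dimension shifting along 0 → R/(x) → R → R/(x) → 0. In degree one, a functional on R/(x) sends 1
to an element killed by x, hence to some xc, and so extends to R as multiplication by c. -/
theorem subsingleton_ext_quotient_span (hx : x * x = 0) (h : ∀ r, x * r = 0 → x ∣ r) (n : ℕ) :
    Subsingleton (Abelian.Ext (ModuleCat.of R (R ⧸ Ideal.span {x})) (ModuleCat.of R R)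
      (n + 1)) := by
  induction n with
  | zero =>
    refine subsingleton_ext_one_of_projective_middle (quotientMulOfSqZero_injective hx h)
      (exact_quotientMulOfSqZero_mkQ hx) (Submodule.mkQ_surjective _) fun φ ↦ ?_
    obtain ⟨c, hc⟩ := h _ (smul_eq_zero_of_quotient_span φ (Ideal.Quotient.mk _ 1))
    refine ⟨LinearMap.mulLeft R c, LinearMap.ext fun a ↦ ?_⟩
    obtain ⟨r, rfl⟩ := Ideal.Quotient.mk_surjective a
    have h1 : (Ideal.Quotient.mk (Ideal.span {x})) r = r • Ideal.Quotient.mk _ 1 := by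
      rw [← Ideal.Quotient.mk_eq_mk, ← Ideal.Quotient.mk_eq_mk, ← Submodule.Quotient.mk_smul,
        smul_eq_mul, mul_one]
    rw [LinearMap.comp_apply, quotientMulOfSqZero_mk, h1, map_smul, hc, LinearMap.mulLeft_apply,
      smul_eq_mul]
    ring
  | succ n ih =>
    exact subsingleton_ext_succ_of_projective_middle (quotientMulOfSqZero_injective hx h)
      (exact_quotientMulOfSqZero_mkQ hx) (Submodule.mkQ_surjective _) (n + 1)

theorem hasGDimZero_quotient_span (hx : x * x = 0) (h : ∀ r, x * r = 0 → x ∣ r) :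
    HasGDimZero R (R ⧸ Ideal.span {x}) := by
  obtain ⟨e⟩ := exists_linearEquiv_dual_quotient_span hx h
  refine ⟨inferInstance, ⟨?_, fun Φ ↦ ?_⟩, fun n hn ↦ ?_, fun n hn ↦ ?_⟩
  · rw [← LinearMap.ker_eq_bot, LinearMap.ker_eq_bot']
    intro a ha
    apply quotientMulOfSqZero_injective hx h
    rw [map_zero]
    exact LinearMap.congr_fun ha (quotientMulOfSqZero hx)
  -- The embedding 1 ↦ x generates the dual, so it determines Φ. Its value under Φ is killed by x,
  -- hence equals xc, which is evaluation at c.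
  · obtain ⟨c, hc⟩ := h _ (smul_eq_zero_of_quotient_span (Φ ∘ₗ e.toLinearMap)
      (e.symm (quotientMulOfSqZero hx)))
    refine ⟨Ideal.Quotient.mk _ c, LinearMap.ext fun φ ↦ ?_⟩
    obtain ⟨d, hd⟩ := h _ (smul_eq_zero_of_quotient_span φ (Ideal.Quotient.mk _ 1))
    have hφ : φ = d • quotientMulOfSqZero hx := by
      ext
      exact hd.trans (by change x * d = d * (x * 1); ring)
    rw [hφ, map_smul, map_smul, Module.Dual.eval_apply, quotientMulOfSqZero_mk, ← hc]
    simp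
  · obtain ⟨n, rfl⟩ := Nat.exists_eq_succ_of_ne_zero hn.ne'
    exact subsingleton_ext_quotient_span hx h n
  · obtain ⟨n, rfl⟩ := Nat.exists_eq_succ_of_ne_zero hn.ne'
    have := subsingleton_ext_quotient_span hx h n
    exact subsingleton_ext_of_retract e.symm.toLinearMap e.toLinearMap (by ext; simp) _

end ExactPair

/-! ### Right minimal approximations and Wakamatsu's lemma. -/

section Approximation

variable {R : Type u} [CommRing R] {X M : Type u} [AddCommGroup X] [Module R X]
  [AddCommGroup M] [Module R M]

/-- Over an Artinian ring, every module with an approximation has a right minimal one. -/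
theorem HasRightGApproximation.exists_rightMinimal [IsArtinianRing R]
    (h : HasRightGApproximation R M) :
    ∃ (X : Type u) (_ : AddCommGroup X) (_ : Module R X) (π : X →ₗ[R] M),
      IsRightGApproximation R π ∧ ∀ φ : X →ₗ[R] X, π ∘ₗ φ = π → Function.Bijective φ := by
  obtain ⟨X, _, _, π, hπ⟩ := h
  have := hπ.hasGDimZero.finite
  obtain ⟨N, hN, hmin⟩ := WellFounded.has_min (wellFounded_lt (α := Submodule R X))
    {N | IsRightGApproximation R (π ∘ₗ N.subtype)} ⟨⊤, by
      refine ⟨hπ.hasGDimZero.of_retract (Submodule.subtype ⊤)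
        (LinearMap.codRestrict ⊤ .id fun _ ↦ trivial) rfl, fun y ↦ ?_, fun X' _ _ hX' f ↦ ?_⟩
      · obtain ⟨a, rfl⟩ := hπ.surjective y
        exact ⟨⟨a, trivial⟩, rfl⟩
      · obtain ⟨g, rfl⟩ := hπ.factors X' hX' f
        exact ⟨LinearMap.codRestrict ⊤ g fun _ ↦ trivial, rfl⟩⟩
  refine ⟨N, inferInstance, inferInstance, π ∘ₗ N.subtype, hN, fun φ hφ ↦ ?_⟩
  have hφn (n : ℕ) (a : N) : π ((φ ^ n) a) = π a := by
    induction n with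
    | zero => rfl
    | succ n ih =>
      rw [pow_succ', ← ih]
      exact LinearMap.congr_fun hφ ((φ ^ n) a)
  -- Fitting's lemma: the range of a high power of φ is a direct summand, so it still carries an
  -- approximation. The exponent n + 1 ensures that this range lies in the range of φ even when n =
  -- 0.
  obtain ⟨n, hn⟩ := (LinearMap.eventually_isCompl_ker_pow_range_pow φ).exists_forall_of_atTop
  have hc := (hn (n + 1) n.le_succ).symm
  set ψ := φ ^ (n + 1) with hψ
  have hrange : IsRightGApproximation R (π ∘ₗ ((LinearMap.range ψ).map N.subtype).subtype) := by
    let e : LinearMap.range ψ →ₗ[R] (LinearMap.range ψ).map N.subtype :=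
      N.subtype.restrict fun a ha ↦ Submodule.mem_map_of_mem ha
    refine ⟨?_, fun y ↦ ?_, fun X' _ _ hX' f ↦ ?_⟩
    · refine (hN.hasGDimZero.of_retract (LinearMap.range ψ).subtype
        (Submodule.projectionOnto _ _ hc) ?_).of_retract
        (Submodule.equivMapOfInjective N.subtype N.injective_subtype
          (LinearMap.range ψ)).symm.toLinearMap
        (Submodule.equivMapOfInjective N.subtype N.injective_subtype
          (LinearMap.range ψ)).toLinearMap ?_
      · ext a; simp
      · ext a; simp
    · obtain ⟨a, rfl⟩ := hN.surjective y
      exact ⟨e ⟨ψ a, a, rfl⟩, hφn (n + 1) a⟩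
    · obtain ⟨g, rfl⟩ := hN.factors X' hX' f
      exact ⟨e ∘ₗ ψ.rangeRestrict ∘ₗ g, LinearMap.ext fun a ↦ hφn (n + 1) (g a)⟩
  have hle : (LinearMap.range ψ).map N.subtype ≤ N := Submodule.map_subtype_le _ _
  have heq := hle.eq_of_not_lt (hmin _ hrange)
  have hsurj : Function.Surjective φ := fun a ↦ by
    have : (a : X) ∈ (LinearMap.range ψ).map N.subtype := by rw [heq]; exact a.2
    obtain ⟨_, ⟨b, rfl⟩, hb⟩ := this
    refine ⟨(φ ^ n) b, ?_⟩
    rw [← Subtype.ext_iff.2 hb, hψ, pow_succ']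
    rfl
  exact IsNoetherian.bijective_of_surjective_endomorphism φ hsurj

variable {π : X →ₗ[R] M} {x : R}

/-- Wakamatsu's lemma for the module `R ⧸ (x)`: its `Ext¹` into the kernel of a right minimal
approximation vanishes. -/
theorem IsRightGApproximation.exists_smul_eq (hπ : IsRightGApproximation R π)
    (hmin : ∀ φ : X →ₗ[R] X, π ∘ₗ φ = π → Function.Bijective φ)
    (hx : x * x = 0) (h : ∀ r, x * r = 0 → x ∣ r) {y : X} (hy : π y = 0) (hxy : x • y = 0) :
    ∃ w, π w = 0 ∧ x • w = y := by
  -- The quotient by N is the pushout of (x) ⊆ R along x ↦ y: an extension of R/(x) by X, hence in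
  -- 𝒢(R).
  let N : Submodule R (X × R) := Submodule.span R {(y, -x)}
  let f : X →ₗ[R] (X × R) ⧸ N := N.mkQ ∘ₗ LinearMap.inl R X R
  let g : ((X × R) ⧸ N) →ₗ[R] R ⧸ Ideal.span {x} :=
    N.liftQ ((Ideal.span {x}).mkQ ∘ₗ LinearMap.snd R X R) <| by
      rw [Submodule.span_le, Set.singleton_subset_iff]
      simp
  let ρ : ((X × R) ⧸ N) →ₗ[R] M := N.liftQ (π ∘ₗ LinearMap.fst R X R) <| by
      rw [Submodule.span_le, Set.singleton_subset_iff]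
      simp [hy]
  have hf : Function.Injective f := by
    rw [← LinearMap.ker_eq_bot, LinearMap.ker_eq_bot']
    intro a ha
    obtain ⟨r, hr⟩ := Submodule.mem_span_singleton.1
      ((Submodule.Quotient.mk_eq_zero N).1 ha)
    simp only [Prod.smul_mk, LinearMap.inl_apply, Prod.mk.injEq] at hr
    obtain ⟨c, rfl⟩ := h r (by simpa [mul_comm] using hr.2)
    rw [← hr.1, mul_comm, mul_smul, hxy, smul_zero]
  have hfg : Function.Exact f g := by
    intro p
    obtain ⟨⟨a, r⟩, rfl⟩ := N.mkQ_surjective p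
    constructor
    · intro h0
      obtain ⟨c, rfl⟩ := Ideal.mem_span_singleton.1
        ((Submodule.Quotient.mk_eq_zero (Ideal.span {x})).1 h0)
      refine ⟨a + c • y, ?_⟩
      refine (Submodule.Quotient.eq N).2 (Submodule.mem_span_singleton.2 ⟨c, ?_⟩)
      simp [mul_comm]
    · rintro ⟨b, hb⟩
      rw [← hb]
      exact map_zero (Ideal.span {x}).mkQ
  have hg : Function.Surjective g := fun a ↦ by
    obtain ⟨r, rfl⟩ := (Ideal.span {x}).mkQ_surjective a
    exact ⟨N.mkQ (0, r), rfl⟩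
  obtain ⟨ρ', hρ'⟩ := hπ.factors _
    (.of_exact hf hfg hg hπ.hasGDimZero (hasGDimZero_quotient_span hx h)) ρ
  -- ρ' ∘ f is an endomorphism over π, hence bijective. Pulling back the image of (0, 1) gives w,
  -- and xw = y because (0, x) and (y, 0) agree modulo N.
  have hbij := hmin (ρ' ∘ₗ f) (LinearMap.ext fun a ↦ LinearMap.congr_fun hρ' (f a))
  obtain ⟨w, hw⟩ := hbij.2 (ρ' (N.mkQ (0, 1)))
  refine ⟨w, ?_, hbij.1 ?_⟩
  · have h1 : π (ρ' (f w)) = π w := LinearMap.congr_fun hρ' (f w)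
    have h2 : π (ρ' (N.mkQ (0, 1))) = π 0 := LinearMap.congr_fun hρ' (N.mkQ (0, 1))
    rw [LinearMap.comp_apply] at hw
    rw [← h1, hw, h2, map_zero]
  · rw [map_smul, hw, LinearMap.comp_apply, ← map_smul, ← map_smul]
    congr 1
    refine ((Submodule.Quotient.eq N).2 (Submodule.mem_span_singleton.2 ⟨1, ?_⟩)).symm
    simp

/-- An element killed by x is a map out of R/(x), and R/(x) is a test object. -/
theorem IsRightGApproximation.exists_smul_eq_zero (hπ : IsRightGApproximation R π)
    (hx : x * x = 0) (h : ∀ r, x * r = 0 → x ∣ r) {z : M} (hz : x • z = 0) :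
    ∃ a, π a = z ∧ x • a = 0 := by
  obtain ⟨g, hg⟩ := hπ.factors _ (hasGDimZero_quotient_span hx h)
    ((Ideal.span {x}).liftQ (LinearMap.toSpanSingleton R M z) <| by
      rw [Ideal.span, Submodule.span_le, Set.singleton_subset_iff]
      simpa using hz)
  refine ⟨g (Ideal.Quotient.mk _ 1), ?_, ?_⟩
  · refine (LinearMap.congr_fun hg (Ideal.Quotient.mk _ 1)).trans ?_
    exact one_smul R z
  · rw [← map_smul]
    convert map_zero g
    exact Ideal.Quotient.eq_zero_iff_mem.2 (Ideal.mem_span_singleton.2 (dvd_mul_right x 1))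

/-- A right minimal approximation of `R ⧸ m` has no free direct summand. -/
theorem not_isUnit_apply_of_rightMinimal [Nontrivial R] {m : Ideal R} {π : X →ₗ[R] R ⧸ m}
    (hmin : ∀ φ : X →ₗ[R] X, π ∘ₗ φ = π → Function.Bijective φ) (hxm : x ∈ m)
    (h : ∀ r, x * r = 0 → x ∣ r) {a : X} (ha : π a = Ideal.Quotient.mk m 1) (hxa : x • a = 0)
    (f : Module.Dual R X) (v : X) : ¬ IsUnit (f v) := by
  intro hv
  obtain ⟨u, hu⟩ : ∃ u, f u = 1 := ⟨hv.unit⁻¹.val • v, by simp⟩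
  obtain ⟨t, ht⟩ := Ideal.Quotient.mk_surjective (π u)
  have hfa : f a ∈ m := by
    obtain ⟨c, hc⟩ := h (f a) (by rw [← smul_eq_mul, ← map_smul, hxa, map_zero])
    rw [hc]
    exact m.mul_mem_right c hxm
  -- Chosen so that f a' = -1 and π a' = 0. Then θ = id + f(·)a' is an endomorphism over π with f ∘
  -- θ = 0, so it misses u.
  let a' := t • (a - f a • u) - u
  have hfa' : f a' = -1 := by simp [a', hu]
  have hπa' : π a' = 0 := by
    have h1 : f a • π u = 0 := by
      rw [← ht]
      exact Ideal.Quotient.eq_zero_iff_mem.2 (m.mul_mem_right t hfa)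
    simp only [a', map_sub, map_smul, h1, sub_zero, ha]
    rw [← ht, sub_eq_zero]
    exact congrArg (Ideal.Quotient.mk m) (mul_one t)
  let θ : X →ₗ[R] X := .id + f.smulRight a'
  have hθ : π ∘ₗ θ = π := by
    ext b
    simp [θ, hπa']
  obtain ⟨b, hb⟩ := (hmin θ hθ).2 u
  have : f (θ b) = 0 := by simp [θ, hfa']
  rw [hb, hu] at this
  exact one_ne_zero this

end Approximation

/-! ### Dimension counts over K for R-modules. -/

section Finrank

open Module

variable {K R : Type*} [Field K] [CommRing R] [Algebra K R]
  {A B : Type*} [AddCommGroup A] [Module R A] [Module K A] [IsScalarTower K R A]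
  [AddCommGroup B] [Module R B] [Module K B] [IsScalarTower K R B]

theorem finrank_range_add_finrank_ker_of_isScalarTower [Module.Finite K A] (f : A →ₗ[R] B) :
    finrank K (LinearMap.range f) + finrank K (LinearMap.ker f) = finrank K A :=
  (f.restrictScalars K).finrank_range_add_finrank_ker

theorem finrank_quotient_add_finrank_of_isScalarTower [Module.Finite K A] (N : Submodule R A) :
    finrank K (A ⧸ N) + finrank K N = finrank K A := by
  rw [← finrank_range_add_finrank_ker_of_isScalarTower (K := K) N.mkQ, N.range_mkQ, N.ker_mkQ]
  congr 1
  exact ((Submodule.topEquiv (R := R) (M := A ⧸ N)).restrictScalars K).finrank_eq.symm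

theorem finrank_lt_finrank_of_lt_of_isScalarTower [Module.Finite K A] {N N' : Submodule R A} (h : N < N') :
    finrank K N < finrank K N' :=
  Submodule.finrank_lt_finrank_of_lt (s := N.restrictScalars K) (t := N'.restrictScalars K) h

instance finite_submodule_of_isScalarTower [Module.Finite K A] (N : Submodule R A) :
    Module.Finite K N :=
  inferInstanceAs (Module.Finite K (N.restrictScalars K))

end Finrank

/-! ### The Artinian algebra R and Hom counts into it. -/

theorem Ideal.mul_mem_sq {R : Type*} [CommRing R] {m : Ideal R} {y z : R} (hy : y ∈ m)
    (hz : z ∈ m) : y * z ∈ m ^ 2 := by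
  rw [pow_two]; exact Ideal.mul_mem_mul hy hz

/-- A finite-dimensional local `K`-algebra `R` with residue field `K = R ⧸ m`, with an element
`x` such that `(0 : x) = (x)` and `x m = m ^ 2`. -/
structure IsExactMinimalAlgebra (K : Type*) {R : Type*} [Field K] [CommRing R] [Algebra K R]
    (m : Ideal R) (x : R) : Prop where
  finite : Module.Finite K R
  ne_top : m ≠ ⊤
  exists_sub_mem : ∀ r : R, ∃ c : K, r - algebraMap K R c ∈ m
  mem : x ∈ m
  sq_eq_zero : x * x = 0
  dvd_of_mul_eq_zero : ∀ r, x * r = 0 → x ∣ r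
  span_mul : Ideal.span {x} * m = m ^ 2

namespace IsExactMinimalAlgebra

open Module

variable {K R : Type*} [Field K] [CommRing R] [Algebra K R] {m : Ideal R} {x : R}
  (H : IsExactMinimalAlgebra K m x)

include H

theorem exists_eq_mul {z : R} (hz : z ∈ m ^ 2) : ∃ w ∈ m, z = x * w := by
  rw [← H.span_mul, Ideal.mem_span_singleton_mul] at hz
  obtain ⟨w, hw, rfl⟩ := hz
  exact ⟨w, hw, rfl⟩

/-- This is 𝔪³ = 0: applying 𝔪² = x𝔪 twice extracts the factor x² = 0. -/
theorem mul_eq_zero {y z : R} (hy : y ∈ m) (hz : z ∈ m ^ 2) : y * z = 0 := by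
  obtain ⟨w, hw, rfl⟩ := H.exists_eq_mul hz
  obtain ⟨w', -, h⟩ := H.exists_eq_mul (Ideal.mul_mem_sq hy hw)
  rw [mul_left_comm, h, ← mul_assoc, H.sq_eq_zero, zero_mul]

theorem isUnit_of_notMem {r : R} (hr : r ∉ m) : IsUnit r := by
  obtain ⟨c, hc⟩ := H.exists_sub_mem r
  have hc0 : c ≠ 0 := by
    rintro rfl
    exact hr (by simpa using hc)
  have hnil : IsNilpotent (r - algebraMap K R c) := by
    refine ⟨3, ?_⟩
    rw [pow_succ', H.mul_eq_zero hc (Ideal.pow_mem_pow hc 2)]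
  have := hnil.isUnit_add_right_of_commute ((isUnit_iff_ne_zero.2 hc0).map (algebraMap K R))
    (Commute.all _ _)
  simpa using this

/-- Annihilation by x gives z = xw; if w were a unit, x would kill 𝔪 and 𝔪² = x𝔪 would vanish. -/
theorem mem_sq_of_forall_mul_eq_zero (hm : m ^ 2 ≠ ⊥) {z : R} (hz : ∀ y ∈ m, y * z = 0) :
    z ∈ m ^ 2 := by
  obtain ⟨w, rfl⟩ := H.dvd_of_mul_eq_zero z (hz x H.mem)
  refine Ideal.mul_mem_sq H.mem ?_
  by_contra hw
  have hu := H.isUnit_of_notMem hw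
  refine hm ((Submodule.eq_bot_iff _).2 fun a ha ↦ ?_)
  obtain ⟨b, hb, rfl⟩ := H.exists_eq_mul ha
  have := hz b hb
  rw [← mul_assoc] at this
  rw [mul_comm]
  exact hu.mul_left_eq_zero.1 this

theorem finrank_quotient : finrank K (R ⧸ m) = 1 := by
  have : Nontrivial (R ⧸ m) := Ideal.Quotient.nontrivial_iff.2 H.ne_top
  refine finrank_eq_one (1 : R ⧸ m) one_ne_zero fun w ↦ ?_
  obtain ⟨r, rfl⟩ := Ideal.Quotient.mk_surjective w
  obtain ⟨c, hc⟩ := H.exists_sub_mem r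
  refine ⟨c, ?_⟩
  rw [← Algebra.algebraMap_eq_smul_one]
  exact ((Ideal.Quotient.eq.2 hc).trans rfl).symm

theorem finrank_maximalIdeal : finrank K R = 1 + finrank K m := by
  have := H.finite
  rw [← H.finrank_quotient, finrank_quotient_add_finrank_of_isScalarTower]

/-- Multiplication by x has kernel and image (x) on R, but kernel (x) and image 𝔪² on 𝔪. Comparing
rank–nullity for the two determines dim (x), and with it dim 𝔪. -/
theorem finrank_maximalIdeal_eq : finrank K m = 2 * finrank K (m ^ 2 : Ideal R) + 1 := by
  have := H.finite
  let f : R →ₗ[R] R := LinearMap.mulLeft R x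
  have hf := finrank_range_add_finrank_ker_of_isScalarTower (K := K) f
  have hker : LinearMap.ker f = LinearMap.range f := by
    ext r
    constructor
    · intro hr
      obtain ⟨c, rfl⟩ := H.dvd_of_mul_eq_zero r hr
      exact ⟨c, rfl⟩
    · rintro ⟨c, rfl⟩
      change x * (x * c) = 0
      rw [← mul_assoc, H.sq_eq_zero, zero_mul]
  have hg := finrank_range_add_finrank_ker_of_isScalarTower (K := K) (f.domRestrict m)
  have hr : LinearMap.range (f.domRestrict m) = m ^ 2 := by
    ext r
    constructor
    · rintro ⟨⟨c, hc⟩, rfl⟩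
      exact Ideal.mul_mem_sq H.mem hc
    · intro hr
      obtain ⟨w, hw, rfl⟩ := H.exists_eq_mul hr
      exact ⟨⟨w, hw⟩, rfl⟩
  have hk : finrank K (LinearMap.ker (f.domRestrict m)) = finrank K (LinearMap.ker f) := by
    have hle : LinearMap.ker f ≤ m := by
      intro r hr
      obtain ⟨c, rfl⟩ := H.dvd_of_mul_eq_zero r hr
      exact m.mul_mem_right c H.mem
    rw [LinearMap.domRestrict, LinearMap.ker_comp]
    exact ((Submodule.comapSubtypeEquivOfLe hle).restrictScalars K).finrank_eq
  have := H.finrank_maximalIdeal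
  rw [hr, hk] at hg
  rw [hker] at hf hg
  omega

/-- The homomorphisms `m → m ⧸ m ^ 2 → m ^ 2 ⊆ R`. -/
theorem finrank_mul_le_finrank_hom [Module.Finite K (m →ₗ[R] R)] :
    (finrank K (m ^ 2 : Ideal R) + 1) * finrank K (m ^ 2 : Ideal R) ≤ finrank K (m →ₗ[R] R) := by
  have := H.finite
  let N : Submodule R m := Submodule.comap (Submodule.subtype m) (m ^ 2)
  have hN : finrank K (m ⧸ N) = finrank K (m ^ 2 : Ideal R) + 1 := by
    have h1 := finrank_quotient_add_finrank_of_isScalarTower (K := K) N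
    have h2 : finrank K N = finrank K (m ^ 2 : Ideal R) :=
      ((Submodule.comapSubtypeEquivOfLe (Ideal.pow_le_self two_ne_zero)).restrictScalars
        K).finrank_eq
    have h3 := H.finrank_maximalIdeal_eq
    omega
  -- Both 𝔪/𝔪² and 𝔪² are killed by 𝔪, so a K-linear map between them is automatically R-linear.
  have hsmul (φ : (m ⧸ N) →ₗ[K] (m ^ 2 : Ideal R)) (r : R) (z : m) :
      (φ (N.mkQ (r • z)) : R) = r * φ (N.mkQ z) := by
    obtain ⟨c, hc⟩ := H.exists_sub_mem r
    have h1 : N.mkQ (r • z) = c • N.mkQ z := by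
      rw [← sub_eq_zero, ← algebraMap_smul R c, ← map_smul, ← map_sub, ← sub_smul]
      exact (Submodule.Quotient.mk_eq_zero _).2 (Ideal.mul_mem_sq hc z.2)
    have h2 : r * φ (N.mkQ z) = algebraMap K R c * φ (N.mkQ z) := by
      rw [← sub_eq_zero, ← sub_mul]
      exact H.mul_eq_zero hc (φ _).2
    rw [h1, map_smul, h2, ← Algebra.smul_def]
    rfl
  let Φ : ((m ⧸ N) →ₗ[K] (m ^ 2 : Ideal R)) →ₗ[K] (m →ₗ[R] R) :=
    { toFun φ :=
        { toFun z := φ (N.mkQ z)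
          map_add' a b := by simp
          map_smul' r z := hsmul φ r z }
      map_add' φ ψ := rfl
      map_smul' c φ := rfl }
  have hΦ : Function.Injective Φ := by
    intro φ ψ h
    refine LinearMap.ext fun a ↦ ?_
    obtain ⟨z, rfl⟩ := N.mkQ_surjective a
    exact Subtype.ext (LinearMap.congr_fun h z)
  have h := (finrank_linearMap K K (m ⧸ N) (m ^ 2 : Ideal R)).symm.trans_le
    (LinearMap.finrank_le_finrank_of_injective hΦ)
  rwa [hN] at h

theorem finite_hom {A : Type*} [AddCommGroup A] [Module R A] [Module K A] [IsScalarTower K R A]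
    [Module.Finite K A] : Module.Finite K (A →ₗ[R] R) :=
  have := H.finite
  .of_injective (LinearMap.restrictScalarsₗ K R A R K) (LinearMap.restrictScalars_injective K)

/-- A module killed by `m` maps to the socle `m ^ 2` of `R`. -/
theorem finrank_hom_le (hm : m ^ 2 ≠ ⊥) {A : Type*} [AddCommGroup A] [Module R A] [Module K A]
    [IsScalarTower K R A] [Module.Finite K A] (hA : ∀ y ∈ m, ∀ a : A, y • a = 0) :
    finrank K (A →ₗ[R] R) ≤ finrank K A * finrank K (m ^ 2 : Ideal R) := by
  have := H.finite
  have hmem (φ : A →ₗ[R] R) (a : A) : φ a ∈ m ^ 2 :=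
    H.mem_sq_of_forall_mul_eq_zero hm fun y hy ↦ by
      rw [← smul_eq_mul, ← map_smul, hA y hy, map_zero]
  let Φ : (A →ₗ[R] R) →ₗ[K] (A →ₗ[K] (m ^ 2 : Ideal R)) :=
    { toFun φ := (φ.codRestrict (m ^ 2) (hmem φ)).restrictScalars K
      map_add' φ ψ := rfl
      map_smul' c φ := rfl }
  have hΦ : Function.Injective Φ := by
    intro φ ψ h
    ext a
    exact congrArg Subtype.val (LinearMap.congr_fun h a)
  exact (LinearMap.finrank_le_finrank_of_injective hΦ).trans_eq (finrank_linearMap K K A _)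

end IsExactMinimalAlgebra

theorem LinearMap.exists_comp_eq_of_ker_le {R A B C : Type*} [Ring R] [AddCommGroup A]
    [Module R A] [AddCommGroup B] [Module R B] [AddCommGroup C] [Module R C] {q : A →ₗ[R] B}
    (hq : Function.Surjective q) {t : A →ₗ[R] C} (h : LinearMap.ker q ≤ LinearMap.ker t) :
    ∃ g : B →ₗ[R] C, g ∘ₗ q = t := by
  refine ⟨(LinearMap.ker q).liftQ t h ∘ₗ (q.quotKerEquivOfSurjective hq).symm.toLinearMap, ?_⟩
  ext a
  have : (q.quotKerEquivOfSurjective hq).symm (q a) = Submodule.Quotient.mk a := by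
    rw [LinearEquiv.symm_apply_eq]; rfl
  simp [this]

/-! ### The Ext¹ inequality and the contradiction. -/

namespace IsExactMinimalAlgebra

open Module

variable {K : Type v} {R : Type u} [Field K] [CommRing R] [Algebra K R] {m : Ideal R} {x : R}
  (H : IsExactMinimalAlgebra K m x)

theorem smul_eq_zero_of_mem_smul_top {X : Type*} [AddCommGroup X] [Module R X]
    (hX : ∀ y ∈ m, ∀ z ∈ m, ∀ v : X, y • z • v = 0) {y : R} (hy : y ∈ m) {n : X}
    (hn : n ∈ m • (⊤ : Submodule R X)) : y • n = 0 := by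
  refine Submodule.smul_induction_on hn (fun z hz v _ ↦ hX y hy z hz v) fun a b ha hb ↦ ?_
  rw [smul_add, ha, hb, add_zero]

include H

/-- A module `X` with `m ^ 2 X = 0` and `Ext¹(X, R) = 0` satisfies `μ(X) ≤ dim (m X)`. -/
theorem finrank_quotient_le_finrank_smul {X : Type u} [AddCommGroup X] [Module R X] [Module K X]
    [IsScalarTower K R X] [Module.Finite K X]
    (h2 : 2 ≤ finrank K (m ^ 2 : Ideal R))
    (hX : ∀ y ∈ m, ∀ z ∈ m, ∀ v : X, y • z • v = 0)
    [Subsingleton (Abelian.Ext (ModuleCat.of R X) (ModuleCat.of R R) 1)] :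
    finrank K (X ⧸ m • (⊤ : Submodule R X)) ≤
      finrank K (m • (⊤ : Submodule R X) : Submodule R X) := by
  have := H.finite
  set N := m • (⊤ : Submodule R X) with hN
  have hN0 {y : R} (hy : y ∈ m) {n : X} (hn : n ∈ N) : y • n = 0 :=
    smul_eq_zero_of_mem_smul_top hX hy hn
  set b := finrank K (X ⧸ N) with hb
  let B : Basis (Fin b) K (X ⧸ N) := finBasis K (X ⧸ N)
  choose v hv using fun j ↦ N.mkQ_surjective (B j)
  let p : (Fin b → R) →ₗ[R] X := Fintype.linearCombination R v
  have hpB (s : Fin b → R) (c : Fin b → K) (hs : ∀ j, s j - algebraMap K R (c j) ∈ m) :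
      N.mkQ (p s) = ∑ j, c j • B j := by
    simp only [p, Fintype.linearCombination_apply, map_sum, ← hv]
    refine Finset.sum_congr rfl fun j _ ↦ ?_
    rw [← algebraMap_smul R (c j), ← map_smul, ← sub_eq_zero, ← map_sub, ← sub_smul]
    exact (Submodule.Quotient.mk_eq_zero N).2 (Submodule.smul_mem_smul (hs j) trivial)
  have hpm {s : Fin b → R} (hs : p s ∈ N) (j : Fin b) : s j ∈ m := by
    choose c hc using fun j ↦ H.exists_sub_mem (s j)
    have h0 := hpB s c hc
    rw [Submodule.mkQ_apply, (Submodule.Quotient.mk_eq_zero N).2 hs] at h0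
    have := Fintype.linearIndependent_iff.1 B.linearIndependent c h0.symm j
    simpa [this] using hc j
  have hsub (w : X) : ∃ s, w - p s ∈ N := by
    refine ⟨fun j ↦ algebraMap K R (B.repr (N.mkQ w) j), ?_⟩
    rw [← Submodule.Quotient.mk_eq_zero, ← Submodule.mkQ_apply, map_sub,
      hpB _ (B.repr (N.mkQ w)) (fun j ↦ by simp), B.sum_repr, sub_self]
  -- A direct substitute for Nakayama: w ≡ p s modulo N, and 𝔪N = 0 turns y • w into p (y • s).
  have hNp : N ≤ LinearMap.range p := by
    refine Submodule.smul_le.2 fun y hy w _ ↦ ?_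
    obtain ⟨s, hs⟩ := hsub w
    refine ⟨y • s, ?_⟩
    have := hN0 hy hs
    rw [smul_sub, sub_eq_zero] at this
    rw [map_smul, this]
  have hp : Function.Surjective p := fun w ↦ by
    obtain ⟨s, hs⟩ := hsub w
    obtain ⟨s', hs'⟩ := hNp hs
    exact ⟨s' + s, by rw [map_add, hs', sub_add_cancel]⟩
  let i : (Fin b → m) →ₗ[R] (Fin b → R) := (Submodule.subtype m).compLeft (Fin b)
  have hiN (τ : Fin b → m) : p (i τ) ∈ N := by
    simp only [p, Fintype.linearCombination_apply]
    exact Submodule.sum_mem _ fun j _ ↦ Submodule.smul_mem_smul (τ j).2 trivial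
  let q : (Fin b → m) →ₗ[R] N := (p ∘ₗ i).codRestrict N hiN
  have hq : Function.Surjective q := by
    rintro ⟨n, hn⟩
    obtain ⟨s, rfl⟩ := hNp hn
    exact ⟨fun j ↦ ⟨s j, hpm hn j⟩, rfl⟩
  -- Vanishing of Ext¹(X, R) extends t from ker p ⊆ 𝔪ᵇ to a functional ψ on Rᵇ. The difference t − ψ
  -- kills ker q, hence factors through N = 𝔪X.
  have hdec (t : (Fin b → m) →ₗ[R] R) :
      ∃ (ψ : (Fin b → R) →ₗ[R] R) (g : N →ₗ[R] R), t = ψ ∘ₗ i + g ∘ₗ q := by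
    let ι : LinearMap.ker p →ₗ[R] (Fin b → m) :=
      { toFun z j := ⟨z.1 j, hpm (by rw [LinearMap.mem_ker.1 z.2]; exact zero_mem N) j⟩
        map_add' _ _ := rfl
        map_smul' _ _ := rfl }
    obtain ⟨ψ, hψ⟩ := exists_comp_eq_of_subsingleton_ext_one (LinearMap.ker p).injective_subtype
      (LinearMap.exact_subtype_ker_map p) hp (t ∘ₗ ι)
    obtain ⟨g, hg⟩ := LinearMap.exists_comp_eq_of_ker_le hq (t := t - ψ ∘ₗ i) (by
      intro τ hτ
      have h0 : p (i τ) = 0 := congrArg Subtype.val (LinearMap.mem_ker.1 hτ)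
      exact sub_eq_zero.2 (LinearMap.congr_fun hψ ⟨i τ, h0⟩).symm)
    exact ⟨ψ, g, by rw [hg]; abel⟩
  -- A functional on R restricts to 𝔪 as multiplication by a scalar, which matters only modulo 𝔪²
  -- because 𝔪³ = 0. Each coordinate thus contributes s + 2 dimensions instead of 2s + 2.
  let α : (R ⧸ m ^ 2) →ₗ[R] (m →ₗ[R] R) :=
    Submodule.liftQ (m ^ 2) (LinearMap.toSpanSingleton R (m →ₗ[R] R) (Submodule.subtype m)) <| by
      intro r hr
      ext z
      exact (mul_comm _ _).trans (H.mul_eq_zero z.2 hr)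
  let Θ : ((Fin b → R ⧸ m ^ 2) × (N →ₗ[R] R)) →ₗ[K] ((Fin b → m) →ₗ[R] R) :=
    ((LinearMap.lsum R (fun _ : Fin b ↦ m) K).toLinearMap ∘ₗ
      (α.restrictScalars K).compLeft (Fin b)).coprod (LinearMap.lcomp K R q)
  have hΘ : Function.Surjective Θ := by
    intro t
    obtain ⟨ψ, g, rfl⟩ := hdec t
    refine ⟨(fun j ↦ Ideal.Quotient.mk _ (ψ (Pi.single j 1)), g), LinearMap.ext fun τ ↦ ?_⟩
    rw [LinearMap.coprod_apply, LinearMap.add_apply, LinearMap.add_apply]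
    congr 1
    rw [LinearMap.comp_apply ψ i, LinearMap.pi_apply_eq_sum_univ ψ]
    refine (LinearMap.sum_apply _ _ _).trans (Finset.sum_congr rfl fun j _ ↦ ?_)
    refine (mul_comm (ψ (Pi.single j 1)) (τ j : R)).trans ?_
    congr 2
    funext l
    exact (Pi.single_apply j (1 : R) l).trans (if_congr eq_comm rfl rfl)
  have := H.finite_hom (A := N)
  have := H.finite_hom (A := m)
  have hle := LinearMap.finrank_le_finrank_of_surjective hΘ
  rw [← (LinearMap.lsum R (fun _ : Fin b ↦ m) K).finrank_eq, finrank_prod,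
    finrank_pi_fintype, finrank_pi_fintype, Finset.sum_const, Finset.sum_const,
    Finset.card_univ, Fintype.card_fin, smul_eq_mul, smul_eq_mul] at hle
  have hm2 : m ^ 2 ≠ ⊥ := by
    intro h
    rw [h, finrank_zero_of_subsingleton] at h2
    omega
  have h3 := H.finrank_hom_le hm2 (A := N) fun y hy a ↦ Subtype.ext (hN0 hy a.2)
  have h4 := H.finrank_mul_le_finrank_hom
  have h5 := finrank_quotient_add_finrank_of_isScalarTower (K := K) (A := R) (m ^ 2)
  have h6 := H.finrank_maximalIdeal
  have h7 := H.finrank_maximalIdeal_eq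
  generalize finrank K (m ^ 2 : Ideal R) = s at *
  have h8 : finrank K (R ⧸ m ^ 2) = s + 2 := by omega
  rw [h8] at hle
  have h9 : b * ((s + 1) * s) ≤ b * (s + 2) + finrank K N * s :=
    (Nat.mul_le_mul_left b h4).trans (hle.trans (by gcongr))
  -- The place where s ≥ 2 is needed: s(s + 1) ≥ 2s + 2 amounts to (s − 2)(s + 1) ≥ 0.
  have h10 : b * (s + 2) + b * s ≤ b * ((s + 1) * s) := by
    rw [← mul_add]
    exact Nat.mul_le_mul_left b (by nlinarith)
  have h11 : b * s ≤ finrank K N * s := Nat.le_of_add_le_add_left (h10.trans h9)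
  exact Nat.le_of_mul_le_mul_right h11 (by omega)

theorem not_hasRightGApproximation (h2 : 2 ≤ finrank K (m ^ 2 : Ideal R)) :
    ¬ HasRightGApproximation R (R ⧸ m) := by
  intro happ
  have := H.finite
  have : IsArtinianRing R := .of_finite K R
  have : Nontrivial R := ⟨0, 1, fun h ↦ H.ne_top
    ((Ideal.eq_top_iff_one m).2 (h ▸ m.zero_mem))⟩
  obtain ⟨X, _, _, π, hπ, hmin⟩ := happ.exists_rightMinimal
  have := hπ.hasGDimZero.finite
  let : Module K X := Module.compHom X (algebraMap K R)
  have : IsScalarTower K R X := .of_algebraMap_smul fun _ _ ↦ rfl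
  have : Module.Finite K X := .trans R X
  obtain ⟨a, ha, hxa⟩ := hπ.exists_smul_eq_zero H.sq_eq_zero H.dvd_of_mul_eq_zero
    (z := Ideal.Quotient.mk m 1) (Ideal.Quotient.eq_zero_iff_mem.2 (m.mul_mem_right 1 H.mem))
  have hfm (f : Module.Dual R X) (v : X) : f v ∈ m := by
    by_contra h
    exact not_isUnit_apply_of_rightMinimal hmin H.mem H.dvd_of_mul_eq_zero ha hxa f v
      (H.isUnit_of_notMem h)
  -- Functionals separate points of X and take values in 𝔪, so they send 𝔪²X into 𝔪³ = 0.
  have hX : ∀ y ∈ m, ∀ z ∈ m, ∀ v : X, y • z • v = 0 := fun y hy z hz v ↦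
    (map_eq_zero_iff _ hπ.hasGDimZero.bijective_dual_eval.1).1 <| LinearMap.ext fun f ↦ by
      rw [Module.Dual.eval_apply, map_smul, map_smul]
      exact H.mul_eq_zero hy (Ideal.mul_mem_sq hz (hfm f v))
  have := hπ.hasGDimZero.ext_eq_zero 1 one_pos
  have hle := H.finrank_quotient_le_finrank_smul h2 hX
  have hquot := finrank_quotient_add_finrank_of_isScalarTower (K := K)
    (m • (⊤ : Submodule R X))
  set N := m • (⊤ : Submodule R X)
  have hπm {y : R} (hy : y ∈ m) (v : X) : π (y • v) = 0 := by
    obtain ⟨t, ht⟩ := Ideal.Quotient.mk_surjective (π v)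
    rw [map_smul, ← ht]
    exact Ideal.Quotient.eq_zero_iff_mem.2 (m.mul_mem_right t hy)
  let ξ : X →ₗ[R] X := LinearMap.lsmul R X x
  let Y := LinearMap.ker π
  have hY : finrank K X = finrank K Y + 1 := by
    rw [← finrank_range_add_finrank_ker_of_isScalarTower π, LinearMap.range_eq_top.2 hπ.surjective,
      ← H.finrank_quotient, add_comm]
    congr 1
    exact ((Submodule.topEquiv (R := R) (M := R ⧸ m)).restrictScalars K).finrank_eq
  have hYξ := finrank_range_add_finrank_ker_of_isScalarTower (K := K) (ξ.domRestrict Y)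
  have hrange : LinearMap.range (ξ.domRestrict Y) = LinearMap.range ξ := by
    refine le_antisymm (LinearMap.range_domRestrict_le_range ξ Y) ?_
    rintro _ ⟨v, rfl⟩
    obtain ⟨t, ht⟩ := Ideal.Quotient.mk_surjective (π v)
    refine ⟨⟨v - t • a, ?_⟩, ?_⟩
    · rw [LinearMap.mem_ker, map_sub, map_smul, ha, ← ht, sub_eq_zero]
      exact congrArg (Ideal.Quotient.mk m) (mul_one t).symm
    · change x • (v - t • a) = x • v
      rw [smul_sub, smul_comm, hxa, smul_zero, sub_zero]
  have hker : finrank K (LinearMap.ker (ξ.domRestrict Y)) = finrank K (LinearMap.range ξ) := by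
    have hle : LinearMap.range ξ ≤ Y := by
      rintro _ ⟨v, rfl⟩
      exact hπm H.mem v
    -- Wakamatsu's lemma supplies the nontrivial inclusion.
    have hcomap : LinearMap.ker (ξ.domRestrict Y) = (LinearMap.range ξ).comap Y.subtype := by
      ext ⟨y, hy⟩
      constructor
      · intro h
        obtain ⟨w, -, hw⟩ := hπ.exists_smul_eq hmin H.sq_eq_zero H.dvd_of_mul_eq_zero hy h
        exact ⟨w, hw⟩
      · rintro ⟨w, hw⟩
        change x • y = 0
        change x • w = y at hw
        rw [← hw, smul_smul, H.sq_eq_zero, zero_smul]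
    rw [hcomap]
    exact ((Submodule.comapSubtypeEquivOfLe hle).restrictScalars K).finrank_eq
  have hξ := finrank_range_add_finrank_ker_of_isScalarTower (K := K) ξ
  have hlt : N < LinearMap.ker ξ := by
    refine lt_of_le_of_ne (fun n hn ↦ smul_eq_zero_of_mem_smul_top hX H.mem hn) fun h ↦ ?_
    have haN : a ∈ N := h ▸ hxa
    have hNY : N ≤ Y := Submodule.smul_le.2 fun y hy v _ ↦ hπm hy v
    have : π a = 0 := hNY haN
    rw [ha] at this
    exact H.ne_top ((Ideal.eq_top_iff_one m).2 (Ideal.Quotient.eq_zero_iff_mem.1 this))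
  have hlt' := finrank_lt_finrank_of_lt_of_isScalarTower (K := K) hlt
  rw [hrange, hker] at hYξ
  -- With r = dim xX: dim X = 2r + 1 and dim ker ξ = r + 1, so dim N ≤ r, whereas dim X/N ≤ dim N
  -- would give dim X ≤ 2r.
  omega

end IsExactMinimalAlgebra

/-! ### Frobenius extensions of principal ideal domains are Gorenstein. -/

section Frobenius

/-- The coinduced `S`-module `Hom_D(S, J)`. -/
def Coinduced (D : Type*) (S : Type*) (J : Type*) [CommRing D] [CommRing S] [Algebra D S]
    [AddCommGroup J] [Module D J] : Type _ := S →ₗ[D] J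

namespace Coinduced

variable {D S J J' : Type*} [CommRing D] [CommRing S] [Algebra D S] [AddCommGroup J] [Module D J]
  [AddCommGroup J'] [Module D J']

instance : AddCommGroup (Coinduced D S J) := inferInstanceAs (AddCommGroup (S →ₗ[D] J))

instance : FunLike (Coinduced D S J) S J := inferInstanceAs (FunLike (S →ₗ[D] J) S J)

instance : Module S (Coinduced D S J) where
  smul s φ := LinearMap.comp φ (LinearMap.mulLeft D s)
  one_smul φ := LinearMap.ext fun t ↦ congrArg φ (one_mul t)
  mul_smul s s' φ := LinearMap.ext fun t ↦ congrArg φ (by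
    change (s * s') * t = s' * (s * t)
    ring)
  smul_zero s := LinearMap.zero_comp _
  smul_add s φ ψ := LinearMap.add_comp _ _ _
  add_smul s s' φ := LinearMap.ext fun t ↦ (congrArg φ (add_mul s s' t)).trans
    (map_add (F := S →ₗ[D] J) φ _ _)
  zero_smul φ := LinearMap.ext fun t ↦ (congrArg φ (zero_mul t)).trans
    (map_zero (F := S →ₗ[D] J) φ)

theorem smul_apply (s t : S) (φ : Coinduced D S J) : (s • φ) t = φ (s * t) := rfl

/-- Functoriality of the coinduced module. -/
def map (f : J →ₗ[D] J') : Coinduced D S J →ₗ[S] Coinduced D S J' where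
  toFun φ := LinearMap.comp f φ
  map_add' φ ψ := LinearMap.comp_add φ ψ f
  map_smul' _ _ := rfl

/-- Hom–restriction adjunction: evaluating at 1 turns an S-map into the coinduced module into a
D-map into J, which extends to S. -/
theorem baer (hJ : Module.Baer D J) : Module.Baer S (Coinduced D S J) := by
  intro I g
  let g₁ : (I.restrictScalars D) →ₗ[D] J :=
    { toFun i := g i 1
      map_add' i j := by
        have : g (i + j) = g i + g j := map_add g i j
        exact congrArg (fun φ : Coinduced D S J ↦ φ 1) this
      map_smul' d i := by
        have h1 : g (algebraMap D S d • (i : I)) = algebraMap D S d • g i := map_smul g _ _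
        have h2 : (d • i : I.restrictScalars D) = (algebraMap D S d • (i : I) : I) :=
          Subtype.ext (Algebra.smul_def d (i : S))
        change g _ 1 = d • g _ 1
        rw [h2, h1, smul_apply, mul_one, Algebra.algebraMap_eq_smul_one]
        exact map_smul (F := S →ₗ[D] J) (g i) d 1 }
  obtain ⟨h, hh⟩ := Module.Baer.extension_property hJ (I.restrictScalars D).subtype
    (I.restrictScalars D).injective_subtype g₁
  refine ⟨LinearMap.toSpanSingleton S (Coinduced D S J) h, fun i hi ↦ LinearMap.ext fun t ↦ ?_⟩
  have h1 : g (t • ⟨i, hi⟩) = t • g ⟨i, hi⟩ := map_smul g _ _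
  have h2 : h (t * i) = g (t • ⟨i, hi⟩) 1 := LinearMap.congr_fun hh (t • ⟨i, hi⟩ : I)
  change h (i * t) = g ⟨i, hi⟩ t
  rw [mul_comm, h2, h1, smul_apply, mul_one]

end Coinduced

theorem Module.Baer.of_isPrincipalIdealRing_of_divisible {D J : Type*} [CommRing D] [IsDomain D]
    [IsPrincipalIdealRing D] [AddCommGroup J] [Module D J]
    (h : ∀ d : D, d ≠ 0 → ∀ j : J, ∃ j', d • j' = j) : Module.Baer D J := by
  intro I g
  obtain ⟨d, rfl⟩ := (IsPrincipalIdealRing.principal I).principal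
  have hd : d ∈ D ∙ d := Submodule.mem_span_singleton_self d
  obtain ⟨j, hj⟩ : ∃ j, d • j = g ⟨d, hd⟩ := by
    by_cases hd0 : d = 0
    · refine ⟨0, ?_⟩
      have : (⟨d, hd⟩ : D ∙ d) = 0 := Subtype.ext hd0
      rw [this, map_zero, smul_zero]
    · exact h d hd0 _
  refine ⟨LinearMap.toSpanSingleton D J j, fun i hi ↦ ?_⟩
  obtain ⟨c, rfl⟩ := Submodule.mem_span_singleton.1 hi
  have : (⟨c • d, hi⟩ : D ∙ d) = c • ⟨d, hd⟩ := rfl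
  rw [this, map_smul g, ← hj, LinearMap.toSpanSingleton_apply, smul_assoc]

variable {D : Type u} {S : Type v} [CommRing D] [IsDomain D] [IsPrincipalIdealRing D] [CommRing S]
  [Algebra D S] [Module.Projective D S]

/-- A Frobenius extension of a principal ideal domain has self-injective dimension at most one. -/
theorem hasInjectiveDimensionLE_one_of_frobenius (l : S →ₗ[D] D)
    (hl : Function.Bijective fun s ↦ l ∘ₗ LinearMap.mulLeft D s) :
    HasInjectiveDimensionLE (ModuleCat.of S S) 1 := by
  -- Hom_D(S, −) is exact since S is projective. Applied to 0 → D → F → F/D → 0 with F and F/D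
  -- divisible, it gives an injective resolution of Hom_D(S, D), which l identifies with S.
  let F := FractionRing D
  let N : Submodule D F := LinearMap.range (Algebra.linearMap D F)
  have hF (d : D) (hd : d ≠ 0) (j : F) : ∃ j', d • j' = j := by
    refine ⟨(algebraMap D F d)⁻¹ * j, ?_⟩
    rw [Algebra.smul_def, mul_inv_cancel_left₀]
    simpa using hd
  have hFN (d : D) (hd : d ≠ 0) (j : F ⧸ N) : ∃ j', d • j' = j := by
    obtain ⟨j, rfl⟩ := N.mkQ_surjective j
    obtain ⟨j', rfl⟩ := hF d hd j
    exact ⟨N.mkQ j', (map_smul _ _ _).symm⟩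
  have b0 := Coinduced.baer (S := S) (Module.Baer.of_isPrincipalIdealRing_of_divisible hF)
  have b1 := Coinduced.baer (S := S) (Module.Baer.of_isPrincipalIdealRing_of_divisible hFN)
  let f : Coinduced D S D →ₗ[S] Coinduced D S F := Coinduced.map (Algebra.linearMap D F)
  let g : Coinduced D S F →ₗ[S] Coinduced D S (F ⧸ N) := Coinduced.map N.mkQ
  have hf : Function.Injective f := fun φ ψ h ↦ LinearMap.ext fun t ↦
    FaithfulSMul.algebraMap_injective D F (LinearMap.congr_fun h t)
  have hg : Function.Surjective g := fun φ ↦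
    Module.projective_lifting_property N.mkQ φ N.mkQ_surjective
  have hfg : Function.Exact f g := by
    intro φ
    constructor
    · intro h
      have h' (t : S) : φ t ∈ N := (Submodule.Quotient.mk_eq_zero N).1 (LinearMap.congr_fun h t)
      obtain ⟨ψ, hψ⟩ := Module.projective_lifting_property (Algebra.linearMap D F).rangeRestrict
        (LinearMap.codRestrict N φ h') (LinearMap.surjective_rangeRestrict _)
      exact ⟨ψ, LinearMap.ext fun t ↦ congrArg Subtype.val (LinearMap.congr_fun hψ t)⟩
    · rintro ⟨ψ, rfl⟩
      exact LinearMap.ext fun t ↦ (Submodule.Quotient.mk_eq_zero N).2 ⟨ψ t, rfl⟩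
  have hS := moduleCat_shortExact hf hfg hg
  have i0 : Injective (ModuleCat.of S (Coinduced D S F)) :=
    (Module.injective_iff_injective_object S _).1 b0.injective
  have i1 : Injective (ModuleCat.of S (Coinduced D S (F ⧸ N))) :=
    (Module.injective_iff_injective_object S _).1 b1.injective
  have h1 : HasInjectiveDimensionLE (ModuleCat.of S (Coinduced D S D)) 1 :=
    (hS.hasInjectiveDimensionLT_X₃_iff 0 i0).1 (injective_iff_hasInjectiveDimensionLT_one.1 i1)
  let e : S →ₗ[S] Coinduced D S D :=
    { toFun s := (l ∘ₗ LinearMap.mulLeft D s : S →ₗ[D] D)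
      map_add' s t := LinearMap.ext fun r ↦ by
        change l ((s + t) * r) = l (s * r) + l (t * r)
        rw [add_mul, map_add]
      map_smul' s t := LinearMap.ext fun r ↦ by
        change l ((s * t) * r) = l (t * (s * r))
        congr 1
        ring }
  rw [← injectiveDimension_le_iff] at h1 ⊢
  exact (ModuleCat.injectiveDimension_eq_of_linearEquiv
    (M := ModuleCat.of S S) (N := ModuleCat.of S (Coinduced D S D))
    (LinearEquiv.ofBijective e hl)).trans_le h1

theorem hasInjectiveDimensionLE_of_isLocalizedModule {S : Type v} [CommRing S]
    [IsNoetherianRing S] (n : ℕ) (M : ModuleCat.{v} S) [HasInjectiveDimensionLE M n]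
    (p : Submonoid S) {N : Type v} [AddCommGroup N] [Module S N] [Module (Localization p) N]
    [IsScalarTower S (Localization p) N] (f : M →ₗ[S] N) [IsLocalizedModule p f] :
    HasInjectiveDimensionLE (ModuleCat.of (Localization p) N) n := by
  have h := ModuleCat.localizedModule_hasInjectiveDimensionLE n p M
  rw [← injectiveDimension_le_iff] at h ⊢
  exact (ModuleCat.injectiveDimension_eq_of_linearEquiv
    (N := ModuleCat.of (Localization p) N) (LinearEquiv.extendScalarsOfIsLocalization p
      (Localization p) (IsLocalizedModule.linearEquiv p (M.localizedModuleMkLinearMap p)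
        f))).symm.trans_le h

theorem isGorenstein_of_hasInjectiveDimensionLE {S : Type v} [CommRing S] [IsNoetherianRing S]
    (n : ℕ) [HasInjectiveDimensionLE (ModuleCat.of S S) n] : IsGorenstein S :=
  ⟨inferInstance, fun m _ ↦ ⟨inferInstance, n,
    hasInjectiveDimensionLE_of_isLocalizedModule n (ModuleCat.of S S) m.primeCompl
      (Algebra.linearMap S (Localization.AtPrime m))⟩⟩

end Frobenius

/-! ### Homogeneous rings: the irrelevant ideal and minimal reductions. -/

section Graded

variable {k : Type u} {S : Type v} [Field k] [CommRing S] [Algebra k S]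
  (𝒜 : ℕ → Submodule k S) [GradedAlgebra 𝒜]

/-- The irrelevant ideal as a bare ideal. -/
abbrev irrelevantIdeal : Ideal S := (HomogeneousIdeal.irrelevant 𝒜).toIdeal

variable {𝒜}

theorem mem_irrelevantIdeal {s : S} : s ∈ irrelevantIdeal 𝒜 ↔ GradedRing.proj 𝒜 0 s = 0 :=
  Iff.rfl

theorem proj_of_mem_same {s : S} {i : ℕ} (hs : s ∈ 𝒜 i) : GradedRing.proj 𝒜 i s = s :=
  DirectSum.decompose_of_mem_same 𝒜 hs

theorem proj_mem (i : ℕ) (s : S) : GradedRing.proj 𝒜 i s ∈ 𝒜 i :=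
  (DirectSum.decompose 𝒜 s i).2

theorem algebraMap_mem_zero (c : k) : algebraMap k S c ∈ 𝒜 0 :=
  SetLike.algebraMap_mem_graded 𝒜 c

theorem proj_mul (a b : S) (i : ℕ) : GradedRing.proj 𝒜 i (a * b) =
    ∑ ij ∈ Finset.HasAntidiagonal.antidiagonal i, GradedRing.proj 𝒜 ij.1 a * GradedRing.proj 𝒜 ij.2 b := by
  simp only [GradedRing.proj_apply, DirectSum.decompose_mul]
  exact DirectSum.coe_mul_apply_eq_sum_antidiagonal 𝒜 _ _ i

theorem proj_one_eq_zero_of_mem_sq {z : S} (hz : z ∈ irrelevantIdeal 𝒜 ^ 2) :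
    GradedRing.proj 𝒜 1 z = 0 := by
  rw [pow_two] at hz
  refine Submodule.mul_induction_on hz (fun a ha b hb ↦ ?_) fun a b ha hb ↦ ?_
  · rw [proj_mul, show Finset.HasAntidiagonal.antidiagonal 1 = {(0, 1), (1, 0)} from rfl,
      Finset.sum_pair (by decide), mem_irrelevantIdeal.1 ha, mem_irrelevantIdeal.1 hb, zero_mul,
      mul_zero, add_zero]
  · rw [map_add, ha, hb, add_zero]

theorem eq_zero_of_mem_one_of_mem_sq {z : S} (h1 : z ∈ 𝒜 1) (hz : z ∈ irrelevantIdeal 𝒜 ^ 2) :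
    z = 0 := by
  rw [← proj_of_mem_same h1, proj_one_eq_zero_of_mem_sq hz]

theorem proj_two_mul {a b : S} (ha : a ∈ irrelevantIdeal 𝒜) (hb : b ∈ irrelevantIdeal 𝒜) :
    GradedRing.proj 𝒜 2 (a * b) = GradedRing.proj 𝒜 1 a * GradedRing.proj 𝒜 1 b := by
  rw [proj_mul, show Finset.HasAntidiagonal.antidiagonal 2 = {(0, 2), (1, 1), (2, 0)} from rfl,
    Finset.sum_insert (by decide), Finset.sum_pair (by decide), mem_irrelevantIdeal.1 ha,
    mem_irrelevantIdeal.1 hb, zero_mul, mul_zero, add_zero, zero_add]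

theorem mem_irrelevantIdeal_of_mem_one {z : S} (hz : z ∈ 𝒜 1) : z ∈ irrelevantIdeal 𝒜 :=
  HomogeneousIdeal.mem_irrelevant_of_mem 𝒜 one_pos hz

theorem algebraMap_eq_zero_of_mem_irrelevantIdeal [Nontrivial S] {c : k}
    (hc : algebraMap k S c ∈ irrelevantIdeal 𝒜) : c = 0 := by
  rw [mem_irrelevantIdeal, proj_of_mem_same (algebraMap_mem_zero c)] at hc
  exact (map_eq_zero (algebraMap k S)).1 hc

theorem irrelevantIdeal_ne_top [Nontrivial S] : irrelevantIdeal 𝒜 ≠ ⊤ := by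
  intro h
  have := algebraMap_eq_zero_of_mem_irrelevantIdeal (𝒜 := 𝒜) (c := 1) (h ▸ trivial)
  exact one_ne_zero this

namespace IsHomogeneousGradedRing

variable (hS : IsHomogeneousGradedRing 𝒜)
include hS

theorem exists_algebraMap_eq {s : S} (hs : s ∈ 𝒜 0) : ∃ c, algebraMap k S c = s := by
  rwa [hS.degree_zero, Submodule.mem_one] at hs

theorem exists_sub_mem (s : S) : ∃ c, s - algebraMap k S c ∈ irrelevantIdeal 𝒜 := by
  obtain ⟨c, hc⟩ := hS.exists_algebraMap_eq (proj_mem 0 s)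
  refine ⟨c, ?_⟩
  rw [mem_irrelevantIdeal, map_sub, proj_of_mem_same (algebraMap_mem_zero c), hc, sub_self]

theorem isMaximal_irrelevantIdeal [Nontrivial S] : (irrelevantIdeal 𝒜).IsMaximal := by
  rw [Ideal.isMaximal_iff]
  refine ⟨(Ideal.ne_top_iff_one _).1 irrelevantIdeal_ne_top, fun J s hJ hs hsJ ↦ ?_⟩
  obtain ⟨c, hc⟩ := hS.exists_sub_mem s
  have hcJ : algebraMap k S c ∈ J := by
    have := J.sub_mem hsJ (hJ hc)
    rwa [sub_sub_cancel] at this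
  have hc0 : c ≠ 0 := by
    rintro rfl
    exact hs (by simpa using hc)
  rw [← (Ideal.eq_top_iff_one J)]
  exact Ideal.eq_top_of_isUnit_mem _ hcJ ((isUnit_iff_ne_zero.2 hc0).map _)

theorem irrelevantIdeal_eq_span : irrelevantIdeal 𝒜 = Ideal.span (𝒜 1 : Set S) := by
  have hle : Ideal.span (𝒜 1 : Set S) ≤ irrelevantIdeal 𝒜 :=
    Ideal.span_le.2 fun z hz ↦ mem_irrelevantIdeal_of_mem_one hz
  refine le_antisymm (fun s hs ↦ ?_) hle
  have key : ∃ c, s - algebraMap k S c ∈ Ideal.span (𝒜 1 : Set S) := by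
    have hs' : s ∈ Algebra.adjoin k (𝒜 1 : Set S) := hS.generated_in_degree_one ▸ trivial
    clear hs
    induction hs' using Algebra.adjoin_induction with
    | mem z hz => exact ⟨0, by simpa using Ideal.subset_span hz⟩
    | algebraMap c => exact ⟨c, by simp⟩
    | add a b _ _ ha hb =>
      obtain ⟨c, hc⟩ := ha
      obtain ⟨d, hd⟩ := hb
      refine ⟨c + d, ?_⟩
      rw [map_add, add_sub_add_comm]
      exact Ideal.add_mem _ hc hd
    | mul a b _ _ ha hb =>
      obtain ⟨c, hc⟩ := ha
      obtain ⟨d, hd⟩ := hb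
      refine ⟨c * d, ?_⟩
      have : a * b - algebraMap k S (c * d) =
          b * (a - algebraMap k S c) + algebraMap k S c * (b - algebraMap k S d) := by
        rw [map_mul]; ring
      rw [this]
      exact Ideal.add_mem _ (Ideal.mul_mem_left _ _ hc) (Ideal.mul_mem_left _ _ hd)
  obtain ⟨c, hc⟩ := key
  have hc0 : GradedRing.proj 𝒜 0 (algebraMap k S c) = 0 := by
    have := mem_irrelevantIdeal.1 (hle hc)
    rw [map_sub, mem_irrelevantIdeal.1 hs, zero_sub, neg_eq_zero] at this
    exact this
  rw [proj_of_mem_same (algebraMap_mem_zero c)] at hc0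
  rwa [hc0, sub_zero] at hc

theorem finiteType : Algebra.FiniteType k S := by
  have := hS.finite_degree_one
  obtain ⟨t, ht⟩ := (Module.Finite.iff_fg.1 this : (𝒜 1).FG)
  exact ⟨t, by rw [← hS.generated_in_degree_one, ← ht, Algebra.adjoin_span]⟩

/-- The homogeneous core of p is a prime inside the irrelevant ideal; by minimality they coincide,
so p contains a maximal ideal. -/
theorem eq_irrelevantIdeal_of_mem_minimalPrimes [Nontrivial S]
    (h : irrelevantIdeal 𝒜 ∈ minimalPrimes S) (p : Ideal S) [hp : p.IsPrime] :
    p = irrelevantIdeal 𝒜 := by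
  have hmax := hS.isMaximal_irrelevantIdeal
  have hle : (p.homogeneousCore 𝒜).toIdeal ≤ irrelevantIdeal 𝒜 := by
    intro s hs
    have h0 : GradedRing.proj 𝒜 0 s ∈ p :=
      Ideal.toIdeal_homogeneousCore_le 𝒜 p ((p.homogeneousCore 𝒜).2 0 hs)
    obtain ⟨c, hc⟩ := hS.exists_algebraMap_eq (proj_mem 0 s)
    rw [mem_irrelevantIdeal, ← hc]
    rw [← hc] at h0
    by_contra hc0
    refine hp.ne_top (Ideal.eq_top_of_isUnit_mem _ h0 (IsUnit.map _ (isUnit_iff_ne_zero.2 ?_)))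
    rintro rfl
    exact hc0 (map_zero _)
  have hge : irrelevantIdeal 𝒜 ≤ (p.homogeneousCore 𝒜).toIdeal :=
    h.2 ⟨hp.homogeneousCore, bot_le⟩ hle
  exact (hmax.eq_of_le hp.ne_top (hge.trans (Ideal.toIdeal_homogeneousCore_le 𝒜 p))).symm

/-- An empty regular sequence would mean that the irrelevant ideal has height zero, making it the
only prime, against dimension one. Otherwise clear the denominator of the first entry. -/
theorem exists_mem_isSMulRegular_localization [Nontrivial S] [hmax : (irrelevantIdeal 𝒜).IsMaximal]
    (hdim : ringKrullDim S = 1) (hCM : IsCohenMacaulay S) :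
    ∃ a ∈ irrelevantIdeal 𝒜, IsSMulRegular (Localization.AtPrime (irrelevantIdeal 𝒜))
      (algebraMap S (Localization.AtPrime (irrelevantIdeal 𝒜)) a) := by
  obtain ⟨-, rs, hrs, hreg, hlen⟩ := hCM.2 (irrelevantIdeal 𝒜)
  rw [IsLocalization.AtPrime.ringKrullDim_eq_height (irrelevantIdeal 𝒜)] at hlen
  cases rs with
  | nil =>
    exfalso
    have h0 : (irrelevantIdeal 𝒜).height = 0 := by
      have : ((0 : ℕ∞) : WithBot ℕ∞) = ((irrelevantIdeal 𝒜).height : WithBot ℕ∞) := by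
        simpa using hlen
      exact (WithBot.coe_injective this).symm
    rw [Ideal.height_eq_zero_iff] at h0
    have : Ring.KrullDimLE 0 S := Ring.krullDimLE_zero_iff.2 fun p hp ↦ by
      rw [hS.eq_irrelevantIdeal_of_mem_minimalPrimes h0 p]
      exact hmax
    have := Ring.krullDimLE_iff.1 this
    rw [hdim] at this
    exact absurd this (by simp)
  | cons r rs =>
    obtain ⟨⟨a, b⟩, hab⟩ := IsLocalization.surj (irrelevantIdeal 𝒜).primeCompl r
    refine ⟨a, ?_, ?_⟩
    · rw [← IsLocalization.AtPrime.to_map_mem_maximal_iff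
        (Localization.AtPrime (irrelevantIdeal 𝒜)) (irrelevantIdeal 𝒜), ← hab]
      exact Ideal.mul_mem_right _ _ (hrs r List.mem_cons_self)
    · rw [← hab]
      have h1 := ((RingTheory.Sequence.isRegular_cons_iff _ r rs).1 hreg).1
      exact h1.mul (IsUnit.isSMulRegular _ (IsLocalization.map_units _ b))

/-- If zs = 0, then b²s = 0 for every b in the irrelevant ideal, as b² is a multiple of z. A locally
regular b kills s in the localization, so ts = 0 for some t outside the ideal; writing t as a
nonzero constant plus an element of the ideal gives s = 0. -/
theorem eq_zero_of_mul_eq_zero [Nontrivial S] (hdim : ringKrullDim S = 1) (hCM : IsCohenMacaulay S)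
    {z : S} (hz : IsMinimalReduction z (irrelevantIdeal 𝒜)) {s : S} (hs : z * s = 0) :
    s = 0 := by
  have := hS.isMaximal_irrelevantIdeal
  obtain ⟨a, ha, hreg⟩ := hS.exists_mem_isSMulRegular_localization hdim hCM
  have hsq {b : S} (hb : b ∈ irrelevantIdeal 𝒜) : b * (b * s) = 0 := by
    have h1 := Ideal.mul_mem_sq hb hb
    rw [← hz.2, Ideal.mem_span_singleton_mul] at h1
    obtain ⟨w, -, hw⟩ := h1
    rw [← mul_assoc, ← hw, mul_right_comm, hs, zero_mul]
  have h0 : algebraMap S (Localization.AtPrime (irrelevantIdeal 𝒜)) s = 0 := by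
    have h1 := congrArg (algebraMap S (Localization.AtPrime (irrelevantIdeal 𝒜))) (hsq ha)
    rw [map_mul, map_mul, map_zero] at h1
    exact hreg.right_eq_zero_of_smul (hreg.right_eq_zero_of_smul h1)
  obtain ⟨⟨t, ht⟩, hts⟩ := (IsLocalization.map_eq_zero_iff (irrelevantIdeal 𝒜).primeCompl _ s).1 h0
  obtain ⟨c, hc⟩ := hS.exists_sub_mem t
  have hc0 : c ≠ 0 := by
    rintro rfl
    exact ht (by simpa using hc)
  have h2 := hsq hc
  have h3 : t * s = 0 := hts
  have h4 : algebraMap k S c * (algebraMap k S c * s) = 0 := by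
    linear_combination h2 - (t - 2 * algebraMap k S c) * h3
  have hu : IsUnit (algebraMap k S c) := (isUnit_iff_ne_zero.2 hc0).map _
  exact hu.mul_right_eq_zero.1 (hu.mul_right_eq_zero.1 h4)

/-- The degree one part of a minimal reduction is again a minimal reduction. -/
theorem isMinimalReduction_proj {x : S} (hx : IsMinimalReduction x (irrelevantIdeal 𝒜)) :
    IsMinimalReduction (GradedRing.proj 𝒜 1 x) (irrelevantIdeal 𝒜) := by
  have h1 : GradedRing.proj 𝒜 1 x ∈ irrelevantIdeal 𝒜 :=
    mem_irrelevantIdeal_of_mem_one (proj_mem 1 x)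
  refine ⟨h1, le_antisymm ?_ ?_⟩
  · rw [pow_two]
    exact Ideal.mul_mono_left ((Ideal.span_singleton_le_iff_mem _).2 h1)
  · rw [pow_two]
    nth_rw 1 2 [hS.irrelevantIdeal_eq_span]
    rw [Ideal.span_mul_span', Ideal.span_le]
    rintro _ ⟨a, ha, b, hb, rfl⟩
    have hab := Ideal.mul_mem_sq (mem_irrelevantIdeal_of_mem_one ha)
      (mem_irrelevantIdeal_of_mem_one hb)
    rw [← hx.2, Ideal.mem_span_singleton_mul] at hab
    obtain ⟨w, hw, hxw⟩ := hab
    -- In degree two, ab = xw reads ab = x₁w₁.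
    have h2 := proj_two_mul hx.1 hw
    have h3 : a * b ∈ 𝒜 2 := SetLike.GradedMul.mul_mem ha hb
    rw [hxw, proj_of_mem_same h3] at h2
    change a * b ∈ _
    rw [h2]
    exact Ideal.mul_mem_mul (Ideal.mem_span_singleton_self _)
      (mem_irrelevantIdeal_of_mem_one (proj_mem 1 w))

end IsHomogeneousGradedRing

end Graded

/-! ### Small embedding dimension over k[z], and the passage to S/(x²). -/

section Graded

variable {k : Type u} {S : Type v} [Field k] [CommRing S] [Algebra k S]
  {𝒜 : ℕ → Submodule k S} [GradedAlgebra 𝒜]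

open Polynomial

theorem aeval_eq_mul_aeval_divX_add (z : S) (f : k[X]) :
    aeval z f = z * aeval z f.divX + algebraMap k S (f.coeff 0) := by
  have := congrArg (aeval z) (Polynomial.divX_mul_X_add f)
  rw [map_add, map_mul, aeval_X, aeval_C] at this
  rw [← this, mul_comm]

theorem coeff_zero_eq_zero_of_aeval_mem [Nontrivial S] {z : S} (hz : z ∈ irrelevantIdeal 𝒜)
    {f : k[X]} (h : aeval z f ∈ irrelevantIdeal 𝒜) : f.coeff 0 = 0 := by
  refine algebraMap_eq_zero_of_mem_irrelevantIdeal (𝒜 := 𝒜) ?_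
  rw [aeval_eq_mul_aeval_divX_add] at h
  exact (Ideal.add_mem_iff_right _ (Ideal.mul_mem_right _ _ hz)).1 h

theorem coeff_eq_zero_of_aeval_eq_zero [Nontrivial S] {z : S} (hz : z ∈ irrelevantIdeal 𝒜)
    (hreg : ∀ s, z * s = 0 → s = 0) (i : ℕ) (f : k[X]) (h : aeval z f = 0) : f.coeff i = 0 := by
  have h0 := coeff_zero_eq_zero_of_aeval_mem hz (h ▸ zero_mem _)
  induction i generalizing f with
  | zero => exact h0
  | succ i ih =>
    rw [aeval_eq_mul_aeval_divX_add, h0, map_zero, add_zero] at h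
    have h' := hreg _ h
    rw [← coeff_divX]
    exact ih f.divX h' (coeff_zero_eq_zero_of_aeval_mem hz (h' ▸ zero_mem _))

/-- Degree zero gives f₀ = 0 and degree one gives f₁z + g₀y = 0, so f₁ = g₀ = 0 by independence. A
factor z can then be cancelled. -/
theorem divX_relation_of_aeval_add_aeval_mul_eq_zero [Nontrivial S] {z y : S} (hz : z ∈ 𝒜 1)
    (hy : y ∈ 𝒜 1) (hreg : ∀ s, z * s = 0 → s = 0)
    (hzy : ∀ a b : k, a • z + b • y = 0 → a = 0 ∧ b = 0) {f g : k[X]}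
    (h : aeval z f + aeval z g * y = 0) :
    f.coeff 0 = 0 ∧ g.coeff 0 = 0 ∧ aeval z f.divX + aeval z g.divX * y = 0 := by
  have hzn := mem_irrelevantIdeal_of_mem_one hz
  have hyn := mem_irrelevantIdeal_of_mem_one hy
  have hf : f.coeff 0 = 0 := coeff_zero_eq_zero_of_aeval_mem hzn <| by
    rw [eq_neg_of_add_eq_zero_left h]
    exact neg_mem (Ideal.mul_mem_left _ _ hyn)
  have hfd := aeval_eq_mul_aeval_divX_add z f
  have hfdd := aeval_eq_mul_aeval_divX_add z f.divX
  have hgd := aeval_eq_mul_aeval_divX_add z g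
  rw [hf, map_zero, add_zero, hfdd] at hfd
  have h1 : f.divX.coeff 0 • z + g.coeff 0 • y = 0 := by
    refine eq_zero_of_mem_one_of_mem_sq (𝒜 := 𝒜)
      (add_mem ((𝒜 1).smul_mem _ hz) ((𝒜 1).smul_mem _ hy)) ?_
    have : f.divX.coeff 0 • z + g.coeff 0 • y =
        -(z * z * aeval z f.divX.divX + z * y * aeval z g.divX) := by
      rw [hfd, hgd] at h
      simp only [Algebra.smul_def]
      linear_combination h
    rw [this]
    exact neg_mem (add_mem (Ideal.mul_mem_right _ _ (Ideal.mul_mem_sq hzn hzn))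
      (Ideal.mul_mem_right _ _ (Ideal.mul_mem_sq hzn hyn)))
  obtain ⟨hf1, hg⟩ := hzy _ _ h1
  refine ⟨hf, hg, hreg _ ?_⟩
  rw [hfd, hgd, hg, map_zero] at h
  rw [hfdd]
  linear_combination h

theorem coeff_eq_zero_of_aeval_add_aeval_mul_eq_zero [Nontrivial S] {z y : S} (hz : z ∈ 𝒜 1)
    (hy : y ∈ 𝒜 1) (hreg : ∀ s, z * s = 0 → s = 0)
    (hzy : ∀ a b : k, a • z + b • y = 0 → a = 0 ∧ b = 0) (i : ℕ) (f g : k[X])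
    (h : aeval z f + aeval z g * y = 0) : f.coeff i = 0 ∧ g.coeff i = 0 := by
  obtain ⟨hf, hg, h'⟩ := divX_relation_of_aeval_add_aeval_mul_eq_zero hz hy hreg hzy h
  induction i generalizing f g with
  | zero => exact ⟨hf, hg⟩
  | succ i ih =>
    obtain ⟨hf', hg', h''⟩ := divX_relation_of_aeval_add_aeval_mul_eq_zero hz hy hreg hzy h'
    simpa only [coeff_divX] using ih f.divX g.divX h' hf' hg' h''

namespace IsHomogeneousGradedRing

variable (hS : IsHomogeneousGradedRing 𝒜)
include hS

theorem isGorenstein_of_degree_one_le_span [Nontrivial S] [IsNoetherianRing S] {z : S}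
    (hz : z ∈ 𝒜 1) (hreg : ∀ s, z * s = 0 → s = 0) (hspan : 𝒜 1 ≤ k ∙ z) : IsGorenstein S := by
  let : Algebra k[X] S := (aeval z).toRingHom.toAlgebra
  have hinj : Function.Injective (Algebra.linearMap k[X] S) := by
    rw [← LinearMap.ker_eq_bot, LinearMap.ker_eq_bot']
    intro f hf
    ext i
    exact coeff_eq_zero_of_aeval_eq_zero (mem_irrelevantIdeal_of_mem_one hz) hreg i f hf
  have hsurj : Function.Surjective (Algebra.linearMap k[X] S) := by
    have : (aeval z : k[X] →ₐ[k] S).range = ⊤ := by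
      rw [eq_top_iff, ← hS.generated_in_degree_one, Algebra.adjoin_le_iff]
      intro a ha
      obtain ⟨c, rfl⟩ := Submodule.mem_span_singleton.1 (hspan ha)
      exact ⟨c • X, by simp⟩
    exact AlgHom.range_eq_top _ |>.1 this
  let e := LinearEquiv.ofBijective _ ⟨hinj, hsurj⟩
  have : Module.Projective k[X] S := .of_equiv e
  have : HasInjectiveDimensionLE (ModuleCat.of S S) 1 := by
    refine hasInjectiveDimensionLE_one_of_frobenius e.symm.toLinearMap ⟨fun s t h ↦ ?_, fun φ ↦ ?_⟩
    · simpa using LinearMap.congr_fun h 1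
    · refine ⟨e (φ 1), LinearMap.ext fun t ↦ ?_⟩
      obtain ⟨f, rfl⟩ := e.surjective t
      have h1 : e f = f • (1 : S) := (Algebra.smul_def f (1 : S)).symm ▸ (mul_one (e f)).symm
      rw [h1, map_smul, map_smul]
      congr 1
      simp
  exact isGorenstein_of_hasInjectiveDimensionLE 1

theorem isGorenstein_of_degree_one_le_span_pair [Nontrivial S] [IsNoetherianRing S] {z y : S}
    (hz : z ∈ 𝒜 1) (hy : y ∈ 𝒜 1) (hreg : ∀ s, z * s = 0 → s = 0)
    (hred : IsMinimalReduction z (irrelevantIdeal 𝒜))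
    (hzy : ∀ a b : k, a • z + b • y = 0 → a = 0 ∧ b = 0)
    (hspan : 𝒜 1 ≤ Submodule.span k {z, y}) : IsGorenstein S := by
  let : Algebra k[X] S := (aeval z).toRingHom.toAlgebra
  -- The reduction property in degree two makes y quadratic over k[z], so 1, y span S.
  obtain ⟨a, b, hab⟩ : ∃ a b : k, y * y = z * (a • z + b • y) := by
    have hyn := mem_irrelevantIdeal_of_mem_one hy
    have h1 := Ideal.mul_mem_sq hyn hyn
    rw [← hred.2, Ideal.mem_span_singleton_mul] at h1
    obtain ⟨w, hw, hzw⟩ := h1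
    have h2 := proj_two_mul hred.1 hw
    have h3 : y * y ∈ 𝒜 2 := SetLike.GradedMul.mul_mem hy hy
    rw [hzw, proj_of_mem_same h3, proj_of_mem_same hz] at h2
    obtain ⟨a, b, h4⟩ := Submodule.mem_span_pair.1 (hspan (proj_mem 1 w))
    exact ⟨a, b, by rw [h2, h4]⟩
  let E : (k[X] × k[X]) →ₗ[k[X]] S :=
    (Algebra.linearMap k[X] S).coprod (LinearMap.toSpanSingleton k[X] S y)
  have hE (f g : k[X]) : E (f, g) = aeval z f + aeval z g * y := rfl
  have hinj : Function.Injective E := by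
    rw [← LinearMap.ker_eq_bot, LinearMap.ker_eq_bot']
    rintro ⟨f, g⟩ hfg
    have h (i : ℕ) := coeff_eq_zero_of_aeval_add_aeval_mul_eq_zero hz hy hreg hzy i f g hfg
    exact Prod.ext (Polynomial.ext fun i ↦ (h i).1) (Polynomial.ext fun i ↦ (h i).2)
  have hsurj : Function.Surjective E := by
    intro s
    have hs : s ∈ Algebra.adjoin k (𝒜 1 : Set S) := hS.generated_in_degree_one ▸ trivial
    induction hs using Algebra.adjoin_induction with
    | mem w hw =>
      obtain ⟨c, d, rfl⟩ := Submodule.mem_span_pair.1 (hspan hw)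
      exact ⟨(c • X, C d), by rw [hE]; simp [Algebra.smul_def]⟩
    | algebraMap c => exact ⟨(C c, 0), by rw [hE]; simp⟩
    | add s t _ _ hs ht =>
      obtain ⟨p, rfl⟩ := hs
      obtain ⟨q, rfl⟩ := ht
      exact ⟨p + q, map_add E p q⟩
    | mul s t _ _ hs ht =>
      obtain ⟨⟨f, g⟩, rfl⟩ := hs
      obtain ⟨⟨f', g'⟩, rfl⟩ := ht
      refine ⟨(f * f' + C a * X ^ 2 * (g * g'), f * g' + f' * g + C b * X * (g * g')), ?_⟩
      simp only [hE, map_add, map_mul, map_pow, aeval_C, aeval_X]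
      simp only [Algebra.smul_def] at hab
      linear_combination -(aeval z g * aeval z g') * hab
  let e := LinearEquiv.ofBijective E ⟨hinj, hsurj⟩
  have : Module.Projective k[X] S := .of_equiv e
  -- The y-coordinate is a Frobenius form: on the basis 1, y its Gram matrix has rows (0, 1) and (1,
  -- bX), with determinant −1. Inverting it yields the preimage of φ used for surjectivity.
  let l : S →ₗ[k[X]] k[X] := LinearMap.snd k[X] k[X] k[X] ∘ₗ e.symm.toLinearMap
  have hl (f g : k[X]) : l (E (f, g)) = g := by
    have : e.symm (E (f, g)) = (f, g) := e.symm_apply_apply (f, g)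
    simp [l, this]
  have hmul (f g : k[X]) : E (f, g) * y = E (C a * X ^ 2 * g, f + C b * X * g) := by
    simp only [hE, map_add, map_mul, map_pow, aeval_C, aeval_X]
    simp only [Algebra.smul_def] at hab
    linear_combination aeval z g * hab
  have : HasInjectiveDimensionLE (ModuleCat.of S S) 1 := by
    refine hasInjectiveDimensionLE_one_of_frobenius l ⟨fun s t h ↦ ?_, fun φ ↦ ?_⟩
    · obtain ⟨⟨f, g⟩, rfl⟩ := hsurj s
      obtain ⟨⟨f', g'⟩, rfl⟩ := hsurj t
      have h1 : l (E (f, g) * 1) = l (E (f', g') * 1) := LinearMap.congr_fun h 1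
      have h2 : l (E (f, g) * y) = l (E (f', g') * y) := LinearMap.congr_fun h y
      rw [mul_one, mul_one, hl, hl] at h1
      rw [hmul, hmul, hl, hl, h1] at h2
      rw [h1, add_right_cancel h2]
    · refine ⟨E (φ y - C b * X * φ 1, φ 1), LinearMap.ext fun t ↦ ?_⟩
      obtain ⟨⟨f, g⟩, rfl⟩ := hsurj t
      have h1 : E (f, g) = f • (1 : S) + g • y := by
        rw [hE, Algebra.smul_def, Algebra.smul_def, mul_one]; rfl
      rw [h1, map_add, map_add, map_smul, map_smul, map_smul, map_smul]
      congr 2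
      · change l (E _ * 1) = _
        rw [mul_one, hl]
      · change l (E _ * y) = _
        rw [hmul, hl]
        ring
  exact isGorenstein_of_hasInjectiveDimensionLE 1

theorem isGorenstein_of_finrank_le_two [Nontrivial S] (hdim : ringKrullDim S = 1)
    (hCM : IsCohenMacaulay S) {x : S} (hx : IsMinimalReduction x (irrelevantIdeal 𝒜))
    (h2 : Module.finrank k (𝒜 1) ≤ 2) : IsGorenstein S := by
  have := hCM.1
  have := hS.finite_degree_one
  have hred := hS.isMinimalReduction_proj hx
  have hz := proj_mem (𝒜 := 𝒜) 1 x
  set z := GradedRing.proj 𝒜 1 x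
  have hreg (s : S) (hs : z * s = 0) : s = 0 := hS.eq_zero_of_mul_eq_zero hdim hCM hred hs
  have hz0 : z ≠ 0 := fun h ↦ one_ne_zero (hreg 1 (by rw [h, zero_mul]))
  by_cases hle : 𝒜 1 ≤ k ∙ z
  · exact hS.isGorenstein_of_degree_one_le_span hz hreg hle
  obtain ⟨y, hy, hyz⟩ := Set.not_subset.1 hle
  have hli : LinearIndependent k ![z, y] := by
    rw [LinearIndependent.pair_iff' hz0]
    exact fun a h ↦ hyz (Submodule.mem_span_singleton.2 ⟨a, h⟩)
  have hspan : Submodule.span k {z, y} = 𝒜 1 := by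
    refine Submodule.eq_of_le_of_finrank_le (Submodule.span_le.2 ?_) ?_
    · rintro w (rfl | rfl)
      exacts [hz, hy]
    · have := finrank_span_eq_card hli
      rw [Matrix.range_cons_cons_empty, Fintype.card_fin] at this
      rwa [this]
  exact hS.isGorenstein_of_degree_one_le_span_pair hz hy hreg hred
    (LinearIndependent.pair_iff.1 hli) hspan.ge

theorem isExactMinimalAlgebra [Nontrivial S] {x : S}
    (hx : IsMinimalReduction x (irrelevantIdeal 𝒜)) (hreg : ∀ s, x * s = 0 → s = 0) :
    IsExactMinimalAlgebra k ((irrelevantIdeal 𝒜).map (Ideal.Quotient.mk (Ideal.span {x ^ 2})))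
      (Ideal.Quotient.mk (Ideal.span {x ^ 2}) x) where
  finite := by
    have := hS.finiteType
    have : Algebra.FiniteType k (S ⧸ Ideal.span {x ^ 2}) :=
      .of_surjective (Ideal.Quotient.mkₐ k (Ideal.span {x ^ 2})) (Ideal.Quotient.mkₐ_surjective k _)
    -- Each element is a constant plus an element of the image of 𝔫, whose cube vanishes because 𝔫³
    -- = x²𝔫.
    have : Algebra.IsIntegral k (S ⧸ Ideal.span {x ^ 2}) := ⟨fun r ↦ by
      obtain ⟨s, rfl⟩ := Ideal.Quotient.mk_surjective r
      obtain ⟨c, hc⟩ := hS.exists_sub_mem s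
      have h3 : (Ideal.Quotient.mk (Ideal.span {x ^ 2}) (s - algebraMap k S c)) ^ 3 = 0 := by
        rw [← map_pow, Ideal.Quotient.eq_zero_iff_mem, Ideal.mem_span_singleton]
        have h1 := Ideal.mul_mem_sq hc hc
        rw [← hx.2, Ideal.mem_span_singleton_mul] at h1
        obtain ⟨w, hw, hw1⟩ := h1
        have h2 := Ideal.mul_mem_sq hc hw
        rw [← hx.2, Ideal.mem_span_singleton_mul] at h2
        obtain ⟨w', -, hw2⟩ := h2
        exact ⟨w', by linear_combination (-(s - algebraMap k S c)) * hw1 - x * hw2⟩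
      have h4 := IsIntegral.of_pow (R := k) three_pos (h3 ▸ isIntegral_zero)
      have h5 : Ideal.Quotient.mk (Ideal.span {x ^ 2}) s =
          Ideal.Quotient.mk _ (s - algebraMap k S c) + algebraMap k _ c := by
        rw [map_sub]
        exact (sub_add_cancel _ (Ideal.Quotient.mk (Ideal.span {x ^ 2}) (algebraMap k S c))).symm
      rw [h5]
      exact h4.add isIntegral_algebraMap⟩
    exact Algebra.IsIntegral.finite
  ne_top h := by
    have h1 := (Ideal.eq_top_iff_one _).1 h
    rw [Ideal.mem_map_iff_of_surjective _ Ideal.Quotient.mk_surjective] at h1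
    obtain ⟨a, ha, ha1⟩ := h1
    have h2 : a - 1 ∈ irrelevantIdeal 𝒜 := by
      refine (Ideal.span_singleton_le_iff_mem _).2 ?_ (Ideal.Quotient.eq.1 (ha1.trans (map_one _).symm))
      exact Ideal.pow_mem_of_mem _ hx.1 2 two_pos
    refine irrelevantIdeal_ne_top (𝒜 := 𝒜) ((Ideal.eq_top_iff_one _).2 ?_)
    simpa using Ideal.sub_mem _ ha h2
  exists_sub_mem r := by
    obtain ⟨s, rfl⟩ := Ideal.Quotient.mk_surjective r
    obtain ⟨c, hc⟩ := hS.exists_sub_mem s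
    exact ⟨c, Ideal.mem_map_of_mem _ hc⟩
  mem := Ideal.mem_map_of_mem _ hx.1
  sq_eq_zero := by
    rw [← map_mul, Ideal.Quotient.eq_zero_iff_mem, ← pow_two]
    exact Ideal.mem_span_singleton_self _
  dvd_of_mul_eq_zero r hr := by
    obtain ⟨s, rfl⟩ := Ideal.Quotient.mk_surjective r
    rw [← map_mul, Ideal.Quotient.eq_zero_iff_mem, Ideal.mem_span_singleton] at hr
    obtain ⟨c, hc⟩ := hr
    have : s - x * c = 0 := hreg _ (by linear_combination hc)
    rw [sub_eq_zero.1 this, map_mul]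
    exact dvd_mul_right _ _
  span_mul := by
    rw [← Ideal.map_pow, ← hx.2, Ideal.map_mul, Ideal.map_span, Set.image_singleton]

/-- S₁ embeds in 𝔪 and meets 𝔪² trivially because x² ∈ 𝔫², so dim S₁ + s ≤ dim 𝔪 = 2s + 1. -/
theorem finrank_degree_one_le [Nontrivial S] {x : S}
    (hx : IsMinimalReduction x (irrelevantIdeal 𝒜)) (hreg : ∀ s, x * s = 0 → s = 0) :
    Module.finrank k (𝒜 1) ≤ Module.finrank k
      ((irrelevantIdeal 𝒜).map (Ideal.Quotient.mk (Ideal.span {x ^ 2})) ^ 2 : Ideal _) + 1 := by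
  have H := hS.isExactMinimalAlgebra hx hreg
  have := H.finite
  have hm := H.finrank_maximalIdeal_eq
  set m := (irrelevantIdeal 𝒜).map (Ideal.Quotient.mk (Ideal.span {x ^ 2})) with hm_def
  let f : 𝒜 1 →ₗ[k] (S ⧸ Ideal.span {x ^ 2}) :=
    (Ideal.Quotient.mkₐ k (Ideal.span {x ^ 2})).toLinearMap ∘ₗ (𝒜 1).subtype
  have hf (a : 𝒜 1) (ha : f a ∈ m ^ 2) : a = 0 := by
    rw [hm_def, ← Ideal.map_pow,
      Ideal.mem_map_iff_of_surjective _ Ideal.Quotient.mk_surjective] at ha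
    obtain ⟨b, hb, hab⟩ := ha
    have h1 : b - a ∈ irrelevantIdeal 𝒜 ^ 2 := by
      refine (Ideal.span_singleton_le_iff_mem _).2 ?_ (Ideal.Quotient.eq.1 hab)
      exact Ideal.pow_mem_pow hx.1 2
    exact Subtype.ext (eq_zero_of_mem_one_of_mem_sq a.2 (by simpa using Ideal.sub_mem _ hb h1))
  have hinj : Function.Injective f := by
    rw [← LinearMap.ker_eq_bot, LinearMap.ker_eq_bot']
    exact fun a ha ↦ hf a (ha ▸ zero_mem _)
  have hinf : LinearMap.range f ⊓ (m ^ 2).restrictScalars k = ⊥ := by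
    rw [eq_bot_iff]
    rintro _ ⟨⟨a, rfl⟩, ha⟩
    rw [hf a ha, map_zero]
    exact zero_mem _
  have hsup : LinearMap.range f ⊔ (m ^ 2).restrictScalars k ≤ m.restrictScalars k := by
    refine sup_le ?_ (Ideal.pow_le_self two_ne_zero)
    rintro _ ⟨a, rfl⟩
    exact Ideal.mem_map_of_mem _ (mem_irrelevantIdeal_of_mem_one a.2)
  have h1 := Submodule.finrank_sup_add_finrank_inf_eq (LinearMap.range f)
    ((m ^ 2).restrictScalars k)
  rw [hinf, finrank_bot, LinearMap.finrank_range_of_inj hinj] at h1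
  have h2 : Module.finrank k _ ≤ Module.finrank k m := Submodule.finrank_mono hsup
  have h3 : Module.finrank k ((m ^ 2).restrictScalars k) = Module.finrank k (m ^ 2 : Ideal _) := rfl
  omega

end IsHomogeneousGradedRing

end Graded

theorem mainTheorem4 {k : Type u} {S : Type v} [Field k] [CommRing S] [Algebra k S]
    (𝒜 : ℕ → Submodule k S) [GradedAlgebra 𝒜] (hS : IsHomogeneousGradedRing 𝒜)
    (hdim : ringKrullDim S = 1) (hCM : IsCohenMacaulay S) (hG : ¬ IsGorenstein S)
    (hmm : HasMinimalMultiplicity (HomogeneousIdeal.irrelevant 𝒜).toIdeal)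
    (x : S) (hx : IsMinimalReduction x (HomogeneousIdeal.irrelevant 𝒜).toIdeal) :
    ¬ HasRightGApproximation (S ⧸ Ideal.span {x ^ 2})
        (residueQuotient (HomogeneousIdeal.irrelevant 𝒜).toIdeal x) ∧
      ¬ GDimZeroContravariantlyFinite (S ⧸ Ideal.span {x ^ 2}) := by
  have : Nontrivial S := by
    by_contra h
    have := not_nontrivial_iff_subsingleton.1 h
    rw [ringKrullDim_eq_bot_of_subsingleton] at hdim
    exact absurd hdim (by simp)
  have hreg (s : S) (hs : x * s = 0) : s = 0 := hS.eq_zero_of_mul_eq_zero hdim hCM hx hs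
  have hnot := (hS.isExactMinimalAlgebra hx hreg).not_hasRightGApproximation <| by
    by_contra h
    have := hS.finrank_degree_one_le hx hreg
    exact hG (hS.isGorenstein_of_finrank_le_two hdim hCM hx (by omega))
  exact ⟨hnot, fun h ↦ hnot (h _ inferInstance)⟩
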